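/- Let $\Sigma$ be a finite alphabet, $N\ge 0$, and let $Y\subseteq\Sigma^{\mathbb N}$ be a topologically transitive subshift of finite type, given by a set $L\subseteq\Sigma^{N+1}$ of allowed words of length $N+1$ ($N=1$ is the case of a transition matrix): $Y$ consists of the sequences all of whose subwords of length $N+1$ lie in $L$. Let $\hat Y\subseteq\Sigma^{\mathbb Z}$ be the two-sided subshift given by the same $L$, and let $T$ denote the shift. Fix $0<\rho<1$ and let $\phi:Y\to\mathbb R$ be Hölder, i.e. $|\phi(\omega)-\phi(\tilde\omega)|\le K\,d(\omega,\tilde\omega)$ for some $K$, where $d(\omega,\tilde\omega)=\rho^{\min\{n:\,\omega_n\ne\tilde\omega_n\}}$. Let $\mu$ be the invariant Gibbs measure on $Y$ for $\phi$, that is, the $T$-invariant Borel probability measure carried by $Y$ such that for some $P\in\mathbb R$ and $K>0$ $$K^{-1}\le\frac{\mu([\omega_0\dots\omega_{n-1}])}{e^{-nP}\,e^{\sum_{j=0}^{n-1}\phi(T^j\omega)}}\le K\qquad(\omega\in Y,\ n\ge 0),$$ and let $\hat\mu$ be its bilateral extension, i.e. the $T$-invariant measure on $\Sigma^{\mathbb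 Z}$ that projects to $\mu$. Let $\mathcal H_k^l$ be the $\sigma$-algebra on $\Sigma^{\mathbb Z}$ generated by the coordinates $\omega_i$, $k\le i\le l$. For a choice of versions of the conditional probabilities $\hat\mu(A\mid\mathcal H_{-\infty}^0)$, $A\in\bigcup_{r<\infty}\mathcal H_1^r$, and for a set $G\subseteq\Sigma^{\mathbb Z}$, put $$\gamma_m(G)=\sup\left\{\left|\frac{\hat\mu(A\mid\mathcal H_{-\infty}^0)(\omega)}{\hat\mu(A\mid\mathcal H_{-\infty}^0)(\tilde\omega)}-1\right|:\ A\in\mathcal H_1^r,\ r<\infty;\ \omega,\tilde\omega\in G,\ \omega_n=\tilde\omega_n\ \text{for all } -m\le n\le 0\right\},$$ where the relative difference is read as $0$ if both probabilities vanish and as $+\infty$ if only the denominator vanishes. Then there is a constant $C$ such that: 1. for a suitable choice of versions, $\gamma_m(\hat Y)<C\rho^m$ for all $m\ge 0$ with $m+1\ge N$; 2. for every choice of versions there is a set $G$ of full $\hat\mu$-measure such that $\gamma_m(G)<C\rho^m$ for all $m\ge 0$ with $m+1\ge N$. (For a subshift given by a transition matrix, $N=1$, this covers all $m\ge0$.)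 -/

import Mathlib

open MeasureTheory ProbabilityTheory
open scoped ENNReal

noncomputable section

namespace GibbsSFT

variable {S : Type*}

/-- The left shift on one-sided sequences. -/
def shift (x : ℕ → S) : ℕ → S := fun n => x (n + 1)

/-- The left shift on two-sided sequences. -/
def shiftZ (x : ℤ → S) : ℤ → S := fun n => x (n + 1)

/-- The projection of a two-sided sequence that erases its negative coordinates. -/
def futureProj (x : ℤ → S) : ℕ → S := fun n => x (n : ℤ)

/-- The one-sided subshift of finite type with set `L` of allowed words of length `N + 1`.
(For `N = 1`, the set `L` is a transition matrix.) -/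
def sft (N : ℕ) (L : Set (Fin (N + 1) → S)) : Set (ℕ → S) :=
  {x | ∀ n : ℕ, (fun k : Fin (N + 1) => x (n + (k : ℕ))) ∈ L}

/-- The two-sided subshift of finite type given by the same allowed words. -/
def sftZ (N : ℕ) (L : Set (Fin (N + 1) → S)) : Set (ℤ → S) :=
  {x | ∀ n : ℤ, (fun k : Fin (N + 1) => x (n + ((k : ℕ) : ℤ))) ∈ L}

/-- Topological transitivity of the shift on a (shift-invariant) set `Y` of sequences: for all
nonempty relatively open `U ∩ Y`, `V ∩ Y`, some point of `U ∩ Y` is eventually mapped into `V`. -/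
def TopTransitive [TopologicalSpace S] (Y : Set (ℕ → S)) : Prop :=
  ∀ U V : Set (ℕ → S), IsOpen U → IsOpen V → (U ∩ Y).Nonempty → (V ∩ Y).Nonempty →
    ∃ n : ℕ, (U ∩ Y ∩ (shift^[n]) ⁻¹' V).Nonempty

open Classical in
/-- The metric `ρ ^ min {n | x n ≠ y n}` on one-sided sequences. -/
def seqDist (ρ : ℝ) (x y : ℕ → S) : ℝ :=
  if h : ∃ n, x n ≠ y n then ρ ^ Nat.find h else 0

/-- `φ` is a Hölder potential on `Y`: Lipschitz for the metric with parameter `ρ`.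
Only the values of `φ` on `Y` matter. -/
def IsHolder (ρ : ℝ) (Y : Set (ℕ → S)) (φ : (ℕ → S) → ℝ) : Prop :=
  ∃ K : ℝ, ∀ x ∈ Y, ∀ y ∈ Y, |φ x - φ y| ≤ K * seqDist ρ x y

/-- The cylinder of the sequences that share their first `n` letters with `x`. -/
def cyl (x : ℕ → S) (n : ℕ) : Set (ℕ → S) := {y | ∀ i < n, y i = x i}

/-- The Gibbs property on `Y` for the potential `φ`, with a pressure `P` and a constant `K`. -/
def HasGibbsProperty [MeasurableSpace S] (Y : Set (ℕ → S)) (φ : (ℕ → S) → ℝ)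
    (μ : Measure (ℕ → S)) : Prop :=
  ∃ P K : ℝ, 0 < K ∧ ∀ x ∈ Y, ∀ n : ℕ,
    K⁻¹ ≤ μ.real (cyl x n) / (Real.exp (-(n * P)) * Real.exp (birkhoffSum shift φ n x)) ∧
    μ.real (cyl x n) / (Real.exp (-(n * P)) * Real.exp (birkhoffSum shift φ n x)) ≤ K

/-- `μ` is the invariant Gibbs measure on `Y` for `φ`: a shift-invariant probability measure
carried by `Y` with the Gibbs property for `φ`. -/
structure IsInvariantGibbs [MeasurableSpace S] (Y : Set (ℕ → S)) (φ : (ℕ → S) → ℝ)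
    (μ : Measure (ℕ → S)) : Prop where
  prob : IsProbabilityMeasure μ
  carried : ∀ᵐ x ∂μ, x ∈ Y
  invariant : MeasurePreserving shift μ μ
  gibbs : HasGibbsProperty Y φ μ

/-- `μZ` is the bilateral extension of the shift-invariant measure `μ`: the (unique)
shift-invariant measure on two-sided sequences that projects to `μ`. -/
structure IsBilateralExtension [MeasurableSpace S] (μ : Measure (ℕ → S))
    (μZ : Measure (ℤ → S)) : Prop where
  invariant : MeasurePreserving shiftZ μZ μZ
  proj : MeasurePreserving futureProj μZ μ

/-- The σ-algebra on two-sided sequences generated by the coordinates with index in `I`. -/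
@[reducible] def coordSigma [MeasurableSpace S] (I : Set ℤ) : MeasurableSpace (ℤ → S) :=
  ⨆ i ∈ I, MeasurableSpace.comap (fun x : ℤ → S => x i) inferInstance

/-- The σ-algebra of the infinite past, generated by the coordinates `i ≤ 0`. -/
@[reducible] def past (S : Type*) [MeasurableSpace S] : MeasurableSpace (ℤ → S) := coordSigma (Set.Iic 0)

/-- `A` is an event of the finite future: it is measurable with respect to the coordinates
`1, …, r` for some finite `r`. -/
def IsFutureEvent [MeasurableSpace S] (A : Set (ℤ → S)) : Prop :=
  ∃ r : ℕ, MeasurableSet[coordSigma (Set.Icc 1 (r : ℤ))] A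

/-- `p` chooses, for each event `A` of the finite future, a version `p A` of the conditional
probability of `A` given the infinite past. -/
def IsCondProbGivenPast [MeasurableSpace S] (μZ : Measure (ℤ → S))
    (p : Set (ℤ → S) → (ℤ → S) → ℝ) : Prop :=
  ∀ A : Set (ℤ → S), IsFutureEvent A →
    StronglyMeasurable[past S] (p A) ∧ p A =ᵐ[μZ] μZ⟦A | past S⟧

/-- The relative difference `|x / y - 1|`, equal to `∞` if only `y` vanishes and to `0` if both
`x` and `y` vanish. -/
def relDiff (x y : ℝ) : ℝ≥0∞ :=
  if y = 0 then (if x = 0 then 0 else ⊤) else ENNReal.ofReal |x / y - 1|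

/-- The supremum of the relative differences of the conditional probabilities of an event of the
finite future, at two points of `G` that agree on the coordinates `-m, …, 0`. -/
def gam [MeasurableSpace S] (p : Set (ℤ → S) → (ℤ → S) → ℝ) (G : Set (ℤ → S)) (m : ℕ) : ℝ≥0∞ :=
  ⨆ (A : Set (ℤ → S)) (_ : IsFutureEvent A) (x ∈ G) (y ∈ G)
    (_ : ∀ n : ℤ, -(m : ℤ) ≤ n → n ≤ 0 → x n = y n), relDiff (p A x) (p A y)

end GibbsSFT

end

/-! Heuristically, let `ν` be an eigenmeasure of the dual transfer operator with weight `E = exp (φ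
- P)`. Putting a word `w` of length `n` in front of a set `B` multiplies its mass by the product of
`E` along the first `n` steps: `ν (w B)` is the integral over `B` of `E_n (w x)`. If `B` lies in a
cylinder of length `m + 1`, the Hölder condition makes `E_n (w x)` constant on `B` up to a factor
`exp (c ρ ^ m)`, uniformly in `w`. So the ratio `ν (w B) / ν (w B')` of two such sets is nearly
independent of the past `w`.

The eigenmeasure comes from `μ` itself (`exists_conformal`). By the Gibbs property all iterates of
the dual operator on `μ` are comparable with `μ`, with densities the orbit products of one function
`Q`. Their upper limit `k` is bounded, positive and satisfies `Q * (k ∘ shift) = k`, so `k μ` is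
fixed and equivalent to `μ`.

The ratio estimate for `ν` (`conformal_cross_ratio_le`) passes to `μ` (`invariant_cross_ratio_le`):
by invariance, `w B` may be preceded by arbitrary long words. The density of `μ` with respect to `ν`
is nearly a function of these extra letters, and the estimate, being linear in the measure of `w B`,
can be summed over them. Eliminating `ν` yields `IsInvariantGibbs.exists_cross_ratio_le`.

For the bilateral extension this bounds the conditional probabilities given finitely many past
coordinates. By martingale convergence these tend almost surely to those given the whole past;
taking upper limits defines a version everywhere and keeps the bound on the whole two-sided
subshift. The alphabet is finite, so there are only countably many future events, and any other
choice of versions agrees with this one off a single null set.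

The condition `N ≤ m + 1` says that the common letters at `-m, …, 0` suffice to decide whether a
past and a future glue to an admissible sequence. -/

noncomputable section

namespace GibbsSFT

/-! ### One-sided sequences, orbit products and cylinders. -/

section Sequences

variable {S : Type*}

/-- Put a letter in front of a one-sided sequence. -/
def prepend (a : S) (x : ℕ → S) : ℕ → S := fun n => Nat.casesOn n a x

@[simp] lemma prepend_zero (a : S) (x : ℕ → S) : prepend a x 0 = a := rfl

@[simp] lemma prepend_succ (a : S) (x : ℕ → S) (n : ℕ) : prepend a x (n + 1) = x n := rfl

@[simp] lemma shift_prepend (a : S) (x : ℕ → S) : shift (prepend a x) = x := rfl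

lemma iterate_shift_apply (n : ℕ) (x : ℕ → S) (i : ℕ) : (shift^[n] x) i = x (i + n) := by
  induction n generalizing x with
  | zero => rfl
  | succ n ih => rw [Function.iterate_succ_apply, ih]; simp [shift, add_assoc]

/-- The product of the weights `E` along the first `n` points of an orbit. -/
def orbitProd (E : (ℕ → S) → ℝ≥0∞) (n : ℕ) (z : ℕ → S) : ℝ≥0∞ :=
  ∏ i ∈ Finset.range n, E (shift^[i] z)

lemma orbitProd_succ (E : (ℕ → S) → ℝ≥0∞) (n : ℕ) :
    orbitProd E (n + 1) = (orbitProd E n ∘ shift) * E := by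
  ext z
  simp [orbitProd, Finset.prod_range_succ']

lemma cyl_succ_inter_preimage (z : ℕ → S) (n : ℕ) (B : Set (ℕ → S)) :
    cyl z (n + 1) ∩ shift^[n + 1] ⁻¹' B
      = {y | y 0 = z 0} ∩ shift ⁻¹' (cyl (shift z) n ∩ shift^[n] ⁻¹' B) := by
  ext y
  simp only [cyl, Set.mem_inter_iff, Set.mem_ofPred_eq, Set.mem_preimage,
    Function.iterate_succ_apply]
  constructor
  · rintro ⟨h, hB⟩
    exact ⟨h 0 (by omega), fun i hi => h (i + 1) (by omega), hB⟩
  · rintro ⟨h0, h, hB⟩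
    refine ⟨fun i hi => ?_, hB⟩
    cases i with
    | zero => exact h0
    | succ i => exact h i (by omega)

lemma cyl_add (z : ℕ → S) (n k : ℕ) :
    cyl z (n + k) = cyl z n ∩ shift^[n] ⁻¹' cyl (shift^[n] z) k := by
  ext y
  simp only [cyl, Set.mem_inter_iff, Set.mem_ofPred_eq, Set.mem_preimage, iterate_shift_apply]
  constructor
  · exact fun h => ⟨fun i hi => h i (by omega), fun i hi => h _ (by omega)⟩
  · rintro ⟨h, h'⟩ i hi
    by_cases hin : i < n
    · exact h i hin
    · simpa [Nat.sub_add_cancel (not_lt.mp hin)] using h' (i - n) (by omega)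

lemma self_mem_cyl (z : ℕ → S) (n : ℕ) : z ∈ cyl z n := fun _ _ => rfl

lemma cyl_eq_of_mem {y z : ℕ → S} {n : ℕ} (h : y ∈ cyl z n) : cyl y n = cyl z n := by
  ext x
  exact forall₂_congr fun i hi => by rw [h i hi]

lemma cyl_anti (z : ℕ → S) {m n : ℕ} (h : m ≤ n) : cyl z n ⊆ cyl z m :=
  fun _ hy i hi => hy i (hi.trans_le h)

variable [TopologicalSpace S]

lemma isOpen_cyl [DiscreteTopology S] (z : ℕ → S) (n : ℕ) : IsOpen (cyl z n) := by
  have : cyl z n = ⋂ i ∈ Finset.range n, (fun y : ℕ → S => y i) ⁻¹' {z i} := by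
    ext; simp [cyl]
  rw [this]
  exact isOpen_biInter_finset fun i _ => (isOpen_discrete _).preimage (continuous_apply i)

lemma exists_cyl_subset {U : Set (ℕ → S)} (hU : IsOpen U) {x : ℕ → S} (hx : x ∈ U) :
    ∃ n, cyl x n ⊆ U := by
  obtain ⟨I, u, hu, hIU⟩ := isOpen_pi_iff.mp hU x hx
  refine ⟨I.sup id + 1, fun y hy => hIU fun i hi => ?_⟩
  rw [hy i (Nat.lt_succ_of_le (Finset.le_sup (f := id) hi))]
  exact (hu i hi).2

end Sequences

/-! ### The dual transfer operator and its iterates. -/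

section Pullback

variable {S : Type*} [MeasurableSpace S]

lemma measurable_prepend (a : S) : Measurable (prepend a) := by
  refine measurable_pi_lambda _ fun n => ?_
  cases n with
  | zero => exact measurable_const
  | succ n => exact measurable_pi_apply n

lemma measurable_shift : Measurable (shift : (ℕ → S) → ℕ → S) :=
  measurable_pi_lambda _ fun n => measurable_pi_apply (n + 1)

/-- The sum over all letters `a` of the images of `α` under `x ↦ a x`. -/
def pullback (α : Measure (ℕ → S)) : Measure (ℕ → S) :=
  Measure.sum fun a => α.map (prepend a)

lemma pullback_apply (α : Measure (ℕ → S)) {A : Set (ℕ → S)} (hA : MeasurableSet A) :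
    pullback α A = ∑' a, α (prepend a ⁻¹' A) := by
  simp only [pullback, Measure.sum_apply _ hA]
  exact tsum_congr fun a => Measure.map_apply (measurable_prepend a) hA

lemma pullback_withDensity_comp_shift (α : Measure (ℕ → S)) {k : (ℕ → S) → ℝ≥0∞}
    (hk : Measurable k) :
    pullback (α.withDensity k) = (pullback α).withDensity (k ∘ shift) := by
  ext A hA
  rw [pullback_apply _ hA, withDensity_apply _ hA, pullback, Measure.restrict_sum _ hA,
    lintegral_sum_measure]
  refine tsum_congr fun a => ?_
  rw [withDensity_apply _ (measurable_prepend a hA),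
    setLIntegral_map hA (hk.comp measurable_shift) (measurable_prepend a)]
  simp

lemma measurable_orbitProd {E : (ℕ → S) → ℝ≥0∞} (hE : Measurable E) (n : ℕ) :
    Measurable (orbitProd E n) :=
  Finset.measurable_fun_prod _ fun i _ => hE.comp (measurable_shift.iterate i)

/-- The dual of the transfer operator with weight `E`. -/
def dualTransfer (E : (ℕ → S) → ℝ≥0∞) (α : Measure (ℕ → S)) : Measure (ℕ → S) :=
  (pullback α).withDensity E

/-- This is the dual form of the identity for the transfer operator that pulls out a factor composed
with the shift; it produces all the cocycle formulas below. -/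
lemma dualTransfer_withDensity {E : (ℕ → S) → ℝ≥0∞} (hE : Measurable E) (α : Measure (ℕ → S))
    {k : (ℕ → S) → ℝ≥0∞} (hk : Measurable k) :
    dualTransfer E (α.withDensity k) = (dualTransfer E α).withDensity (k ∘ shift) := by
  have hk' : Measurable (k ∘ shift) := hk.comp measurable_shift
  rw [dualTransfer, dualTransfer, pullback_withDensity_comp_shift α hk,
    ← withDensity_mul _ hk' hE, ← withDensity_mul _ hE hk', mul_comm]

lemma iterate_dualTransfer {E : (ℕ → S) → ℝ≥0∞} (hE : Measurable E) (α : Measure (ℕ → S))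
    (n : ℕ) : (dualTransfer E)^[n] α = (pullback^[n] α).withDensity (orbitProd E n) := by
  induction n with
  | zero =>
    have : orbitProd E 0 = 1 := by ext; simp [orbitProd]
    simp [this]
  | succ n ih =>
    have h := measurable_orbitProd hE n
    rw [Function.iterate_succ_apply', Function.iterate_succ_apply', ih,
      dualTransfer_withDensity hE _ h, orbitProd_succ, dualTransfer,
      ← withDensity_mul _ hE (h.comp measurable_shift), mul_comm]

lemma iterate_dualTransfer_of_eq_withDensity {E : (ℕ → S) → ℝ≥0∞} (hE : Measurable E)
    {α : Measure (ℕ → S)} {Q : (ℕ → S) → ℝ≥0∞} (hQ : Measurable Q)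
    (h : dualTransfer E α = α.withDensity Q) (n : ℕ) :
    (dualTransfer E)^[n] α = α.withDensity (orbitProd Q n) := by
  induction n with
  | zero =>
    have : orbitProd Q 0 = 1 := by ext; simp [orbitProd]
    simp [this]
  | succ n ih =>
    have h' := measurable_orbitProd hQ n
    rw [Function.iterate_succ_apply', ih, dualTransfer_withDensity hE _ h', h, orbitProd_succ,
      ← withDensity_mul _ hQ (h'.comp measurable_shift), mul_comm]

section Cylinders

variable [MeasurableSingletonClass S]

lemma measurableSet_cyl (z : ℕ → S) (n : ℕ) : MeasurableSet (cyl z n) := by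
  have : cyl z n = ⋂ i, ⋂ (_ : i < n), (fun y : ℕ → S => y i) ⁻¹' {z i} := by
    ext; simp [cyl]
  rw [this]
  exact .iInter fun i => .iInter fun _ => measurable_pi_apply i (measurableSet_singleton _)

lemma pullback_head_inter (α : Measure (ℕ → S)) (a : S) {D : Set (ℕ → S)}
    (hD : MeasurableSet D) : pullback α ({y | y 0 = a} ∩ shift ⁻¹' D) = α D := by
  have hm : MeasurableSet ({y : ℕ → S | y 0 = a} ∩ shift ⁻¹' D) :=
    (measurable_pi_apply (X := fun _ : ℕ => S) 0 (measurableSet_singleton a)).inter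
      (measurable_shift hD)
  rw [pullback_apply _ hm, tsum_eq_single a]
  · congr 1
    ext x
    simp
  · intro b hb
    convert measure_empty (μ := α)
    ext x
    simp [hb]

/-- The iterated pullback puts every word of length `n` in front of `α`; only the word of the
cylinder contributes. -/
lemma iterate_pullback_cyl_inter (α : Measure (ℕ → S)) (z : ℕ → S) (n : ℕ) {B : Set (ℕ → S)}
    (hB : MeasurableSet B) :
    (pullback^[n] α) (cyl z n ∩ shift^[n] ⁻¹' B) = α B := by
  induction n generalizing z with
  | zero => simp [cyl]
  | succ n ih =>
    rw [cyl_succ_inter_preimage, Function.iterate_succ_apply', pullback_head_inter, ih]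
    exact (measurableSet_cyl _ _).inter ((measurable_shift.iterate n) hB)

end Cylinders

lemma ae_iterate_pullback [Countable S] {α : Measure (ℕ → S)} {Y : Set (ℕ → S)}
    (hY : MeasurableSet Y)
    (h : ∀ᵐ x ∂α, x ∈ Y) (n : ℕ) : ∀ᵐ x ∂(pullback^[n] α), shift^[n] x ∈ Y := by
  induction n with
  | zero => exact h
  | succ n ih =>
    rw [Function.iterate_succ_apply']
    rw [pullback, Measure.ae_sum_iff]
    · intro a
      rw [ae_map_iff (measurable_prepend a).aemeasurable]
      · simpa [Function.iterate_succ_apply] using ih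
      · exact (measurable_shift.iterate _) hY

end Pullback

/-! ### Comparison of measures through cylinders. -/

section CylinderComparison

section

variable {S : Type*} [Finite S] [MeasurableSpace S] [MeasurableSingletonClass S]

/-- Two measures that compare on the cylinders of length `n` compare on the unions of them. -/
lemma measure_le_of_forall_cyl_le {α β : Measure (ℕ → S)} {n : ℕ}
    (h : ∀ z, α (cyl z n) ≤ β (cyl z n)) {U : Set (ℕ → S)} (hU : ∀ x ∈ U, cyl x n ⊆ U) :
    α U ≤ β U := by
  classical
  have := Fintype.ofFinite S
  let r : (ℕ → S) → Fin n → S := fun x i => x i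
  have hr : Measurable r := measurable_pi_lambda _ fun i => measurable_pi_apply _
  have hcyl : ∀ x, r ⁻¹' {r x} = cyl x n := fun x => by
    ext y
    simp only [Set.mem_preimage, Set.mem_singleton_iff, funext_iff, r, cyl, Set.mem_ofPred_eq]
    exact ⟨fun h i hi => h ⟨i, hi⟩, fun h i => h i i.2⟩
  have hUr : U = r ⁻¹' (r '' U) := by
    refine Set.Subset.antisymm (Set.subset_preimage_image _ _) ?_
    rintro y ⟨x, hx, hxy⟩
    exact hU x hx (hcyl x ▸ hxy.symm)
  have key : ∀ γ : Measure (ℕ → S), γ U = ∑ v ∈ (r '' U).toFinset, γ (r ⁻¹' {v}) := fun γ => by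
    rw [← measure_biUnion_finset]
    · conv_lhs => rw [hUr]
      congr 1
      ext
      simp [eq_comm]
    · intro v _ w _ hvw
      exact (Set.disjoint_singleton.mpr hvw).preimage r
    · exact fun v _ => hr (measurableSet_singleton v)
  rw [key, key]
  refine Finset.sum_le_sum fun v hv => ?_
  obtain ⟨x, -, rfl⟩ := Set.mem_toFinset.mp hv
  rw [hcyl]
  exact h x

end

variable {S : Type*} [Finite S] [TopologicalSpace S] [DiscreteTopology S]
  [MeasurableSpace S] [BorelSpace S]

/-- Finite measures that compare on all long cylinders compare on all sets. -/
lemma measure_le_of_forall_long_cyl_le {α β : Measure (ℕ → S)} [IsFiniteMeasure β] (n₀ : ℕ)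
    (h : ∀ z, ∀ n ≥ n₀, α (cyl z n) ≤ β (cyl z n)) : α ≤ β := by
  have hopen : ∀ U : Set (ℕ → S), IsOpen U → α U ≤ β U := fun U hU => by
    -- Any open set is the increasing union of the sets `V n`, and each `V n` is a union of
    -- cylinders of length `n + n₀`. Outer regularity of `β` then passes from open sets to all sets.
    let V : ℕ → Set (ℕ → S) := fun n => {x | cyl x (n + n₀) ⊆ U}
    have hV : Monotone V := fun a b hab x hx =>
      (cyl_anti x (by omega)).trans hx
    have hUV : U = ⋃ n, V n := by
      ext x
      simp only [Set.mem_iUnion, V, Set.mem_ofPred_eq]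
      constructor
      · intro hx
        obtain ⟨n, hn⟩ := exists_cyl_subset hU hx
        exact ⟨n, (cyl_anti x (by omega)).trans hn⟩
      · rintro ⟨n, hn⟩
        exact hn (self_mem_cyl x _)
    rw [hUV, hV.measure_iUnion, hV.measure_iUnion]
    refine iSup_mono fun n => measure_le_of_forall_cyl_le (n := n + n₀)
      (fun z => h z _ (by omega)) fun x hx y hy => ?_
    simp only [V, Set.mem_ofPred_eq] at hx ⊢
    rwa [cyl_eq_of_mem hy]
  refine Measure.le_intro fun A _ _ => ENNReal.le_of_forall_pos_le_add fun ε hε _ => ?_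
  obtain ⟨U, hAU, hU, hle⟩ := A.exists_isOpen_le_add β (ε := ε) (by exact_mod_cast hε.ne')
  exact (measure_mono hAU).trans ((hopen U hU).trans hle)

end CylinderComparison

/-! ### Admissible sequences and the weight of the potential. -/

section Weight

variable {S : Type*}

lemma orbitProd_add (E : (ℕ → S) → ℝ≥0∞) (n k : ℕ) (z : ℕ → S) :
    orbitProd E (n + k) z = orbitProd E n z * orbitProd E k (shift^[n] z) := by
  simp [orbitProd, Finset.prod_range_add, ← Function.iterate_add_apply, add_comm]

lemma iterate_shift_mem_sft {N : ℕ} {L : Set (Fin (N + 1) → S)} {z : ℕ → S} (hz : z ∈ sft N L)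
    (n : ℕ) : shift^[n] z ∈ sft N L := by
  intro i
  convert hz (n + i) using 2
  rw [iterate_shift_apply]
  congr 1
  omega

/-- Gluing: a point that agrees with an admissible point and continues admissibly after
sufficient overlap is admissible. -/
lemma mem_sft_of_mem_cyl {N : ℕ} {L : Set (Fin (N + 1) → S)} {y z : ℕ → S} {n k : ℕ}
    (hz : z ∈ sft N L) (hy : y ∈ cyl z (n + k)) (hn : shift^[n] y ∈ sft N L) (hk : N ≤ k) :
    y ∈ sft N L := by
  intro i
  by_cases hi : i < n
  · convert hz i using 2 with j
    exact hy _ (by omega)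
  · convert hn (i - n) using 2 with j
    rw [iterate_shift_apply]
    congr 1
    omega

lemma seqDist_le_of_mem_cyl {ρ : ℝ} (hρ0 : 0 < ρ) (hρ1 : ρ < 1) {x y : ℕ → S} {n : ℕ}
    (h : x ∈ cyl y n) : seqDist ρ x y ≤ ρ ^ n := by
  classical
  rw [seqDist]
  split_ifs with hne
  · refine pow_le_pow_of_le_one hρ0.le hρ1.le ?_
    by_contra hlt
    exact Nat.find_spec hne (h _ (not_le.mp hlt))
  · positivity

open Classical in
/-- The weight `exp (φ - P)` on `Y`, extended by zero. -/
def weight (Y : Set (ℕ → S)) (φ : (ℕ → S) → ℝ) (P : ℝ) (z : ℕ → S) : ℝ≥0∞ :=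
  ENNReal.ofReal (Y.piecewise (fun z => Real.exp (φ z - P)) (fun _ => 0) z)

lemma orbitProd_weight_of_mem {N : ℕ} {L : Set (Fin (N + 1) → S)} (φ : (ℕ → S) → ℝ) (P : ℝ)
    {z : ℕ → S} (hz : z ∈ sft N L) (n : ℕ) :
    orbitProd (weight (sft N L) φ P) n z
      = ENNReal.ofReal (Real.exp (birkhoffSum shift φ n z - n * P)) := by
  have h : ∀ i ∈ Finset.range n, weight (sft N L) φ P (shift^[i] z)
      = ENNReal.ofReal (Real.exp (φ (shift^[i] z) - P)) := fun i _ => by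
    classical
    simp [weight, Set.piecewise_eq_of_mem _ _ _ (iterate_shift_mem_sft hz i)]
  rw [orbitProd, Finset.prod_congr rfl h, ← ENNReal.ofReal_prod_of_nonneg fun _ _ => by positivity,
    ← Real.exp_sum, Finset.sum_sub_distrib, birkhoffSum]
  simp

/-- The factor at time `0` vanishes. Extending the weight by zero thus removes the inadmissible
words that the pullback puts in front of points of `Y`. -/
lemma orbitProd_weight_of_notMem {Y : Set (ℕ → S)} (φ : (ℕ → S) → ℝ) (P : ℝ)
    {z : ℕ → S} {n : ℕ} (hz : z ∉ Y) (hn : shift^[n] z ∈ Y) :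
    orbitProd (weight Y φ P) n z = 0 := by
  cases n with
  | zero => exact absurd hn hz
  | succ n => simp [orbitProd, Finset.prod_range_succ', weight, hz]

section

variable [TopologicalSpace S] [DiscreteTopology S]

lemma isClosed_sft (N : ℕ) (L : Set (Fin (N + 1) → S)) : IsClosed (sft N L) := by
  have : sft N L = ⋂ n, (fun (x : ℕ → S) (k : Fin (N + 1)) => x (n + (k : ℕ))) ⁻¹' L := by
    ext; simp [sft]
  rw [this]
  refine isClosed_iInter fun n => (isClosed_discrete L).preimage ?_
  exact continuous_pi fun k => continuous_apply _

lemma IsHolder.continuousOn {ρ : ℝ} (hρ0 : 0 < ρ) (hρ1 : ρ < 1) {Y : Set (ℕ → S)}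
    {φ : (ℕ → S) → ℝ} (h : IsHolder ρ Y φ) : ContinuousOn φ Y := by
  obtain ⟨K, hK⟩ := h
  intro x hx
  rw [ContinuousWithinAt, Metric.tendsto_nhds]
  intro ε hε
  have hlim : Filter.Tendsto (fun n : ℕ => |K| * ρ ^ n) Filter.atTop (nhds 0) := by
    simpa using (tendsto_pow_atTop_nhds_zero_of_lt_one hρ0.le hρ1).const_mul |K|
  obtain ⟨n, hn⟩ := (hlim.eventually_lt_const hε).exists
  filter_upwards [self_mem_nhdsWithin,
    mem_nhdsWithin_of_mem_nhds ((isOpen_cyl x n).mem_nhds (self_mem_cyl x n))] with y hy hyx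
  rw [Real.dist_eq]
  have hd : 0 ≤ seqDist ρ y x := by
    rw [seqDist]; split_ifs <;> positivity
  calc |φ y - φ x| ≤ K * seqDist ρ y x := hK y hy x hx
    _ ≤ |K| * ρ ^ n := mul_le_mul (le_abs_self K) (seqDist_le_of_mem_cyl hρ0 hρ1 hyx) hd
        (abs_nonneg K)
    _ < ε := hn

variable [Finite S] [MeasurableSpace S] [BorelSpace S]

lemma measurable_weight {Y : Set (ℕ → S)} (hY : IsClosed Y) {φ : (ℕ → S) → ℝ}
    (hφ : ContinuousOn φ Y) (P : ℝ) : Measurable (weight Y φ P) := by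
  classical
  refine ENNReal.measurable_ofReal.comp ?_
  refine ContinuousOn.measurable_piecewise ?_ continuousOn_const hY.measurableSet
  exact Real.continuous_exp.comp_continuousOn (hφ.sub continuousOn_const)

end

end Weight

/-! ### The Gibbs property in multiplicative form. -/

section Gibbs

variable {S : Type*} [MeasurableSpace S]

/-- The Gibbs property, in terms of a weight `E`. -/
def IsGibbsFor (Y : Set (ℕ → S)) (E : (ℕ → S) → ℝ≥0∞) (μ : Measure (ℕ → S)) (c : ℝ≥0∞) : Prop :=
  ∀ z ∈ Y, ∀ n, μ (cyl z n) ≤ c * orbitProd E n z ∧ orbitProd E n z ≤ c * μ (cyl z n)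

lemma HasGibbsProperty.exists_isGibbsFor {N : ℕ} {L : Set (Fin (N + 1) → S)}
    {φ : (ℕ → S) → ℝ} {μ : Measure (ℕ → S)} [IsFiniteMeasure μ]
    (h : HasGibbsProperty (sft N L) φ μ) :
    ∃ (P : ℝ) (c : ℝ≥0∞), c ≠ ⊤ ∧
      IsGibbsFor (sft N L) (weight (sft N L) φ P) μ c := by
  obtain ⟨P, K, hK, h⟩ := h
  refine ⟨P, ENNReal.ofReal K, ENNReal.ofReal_ne_top, fun z hz n => ?_⟩
  obtain ⟨h1, h2⟩ := h z hz n
  have he : Real.exp (-(n * P)) * Real.exp (birkhoffSum shift φ n z)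
      = Real.exp (birkhoffSum shift φ n z - n * P) := by rw [← Real.exp_add]; congr 1; ring
  rw [he] at h1 h2
  have hpos := Real.exp_pos (birkhoffSum shift φ n z - n * P)
  rw [orbitProd_weight_of_mem φ P hz, ← ofReal_measureReal (measure_ne_top μ (cyl z n)),
    ← ENNReal.ofReal_mul hK.le, ← ENNReal.ofReal_mul hK.le]
  refine ⟨ENNReal.ofReal_le_ofReal ((div_le_iff₀ hpos).mp h2), ENNReal.ofReal_le_ofReal ?_⟩
  rw [le_div_iff₀ hpos] at h1
  calc _ = K * (K⁻¹ * Real.exp (birkhoffSum shift φ n z - n * P)) := by field_simp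
    _ ≤ _ := by gcongr

lemma measure_cyl_eq_zero {μ : Measure (ℕ → S)} {Y : Set (ℕ → S)}
    (hμY : ∀ᵐ x ∂μ, x ∈ Y) {z : ℕ → S} {n : ℕ}
    (h : ∀ y ∈ cyl z n, y ∉ Y) : μ (cyl z n) = 0 :=
  measure_mono_null (fun y hy => h y hy) hμY

end Gibbs

/-! ### A conformal measure equivalent to the Gibbs measure. -/

section Conformal

variable {S : Type*} [Finite S] [TopologicalSpace S] [DiscreteTopology S]
  [MeasurableSpace S] [BorelSpace S]

variable {N : ℕ} {L : Set (Fin (N + 1) → S)} {φ : (ℕ → S) → ℝ} {P : ℝ}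
  {μ : Measure (ℕ → S)} [IsFiniteMeasure μ] {c : ℝ≥0∞}

lemma iterate_pullback_cyl (α : Measure (ℕ → S)) (z : ℕ → S) (n k : ℕ) :
    (pullback^[n] α) (cyl z (n + k)) = α (cyl (shift^[n] z) k) := by
  rw [cyl_add, iterate_pullback_cyl_inter _ _ _ (measurableSet_cyl _ _)]

/-- On a cylinder of length `n + k` the density `E_n` is at most `c * c` times the mass of the
cylinder over the mass `M` of its shifted cylinder, by the Gibbs property at lengths `n + k` and
`k`. The iterated pullback charges the cylinder with exactly `M`, which cancels. -/
lemma iterate_dualTransfer_le (hE : Measurable (weight (sft N L) φ P))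
    (hμY : ∀ᵐ x ∂μ, x ∈ sft N L) (hμ : IsGibbsFor (sft N L) (weight (sft N L) φ P) μ c)
    (hc : c ≠ ⊤) (n : ℕ) :
    (dualTransfer (weight (sft N L) φ P))^[n] μ ≤ (c * c) • μ := by
  set E := weight (sft N L) φ P
  have : IsFiniteMeasure ((c * c) • μ) := μ.smul_finite (ENNReal.mul_ne_top hc hc)
  refine measure_le_of_forall_long_cyl_le n fun z j hj => ?_
  obtain ⟨k, rfl⟩ := Nat.exists_eq_add_of_le hj
  rw [iterate_dualTransfer hE, withDensity_apply _ (measurableSet_cyl _ _), Measure.smul_apply,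
    smul_eq_mul]
  set M := μ (cyl (shift^[n] z) k) with hM
  have hM' : (pullback^[n] μ) (cyl z (n + k)) = M := iterate_pullback_cyl μ z n k
  by_cases hM0 : M = 0
  · rw [setLIntegral_measure_zero _ _ (hM'.trans hM0)]
    exact zero_le
  have hbound : ∀ᵐ y ∂(pullback^[n] μ).restrict (cyl z (n + k)),
      orbitProd E n y ≤ c * c * μ (cyl z (n + k)) / M := by
    filter_upwards [ae_restrict_mem (measurableSet_cyl _ _),
      ae_restrict_of_ae (ae_iterate_pullback (isClosed_sft N L).measurableSet hμY n)] with y hy hyn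
    by_cases hyY : y ∈ sft N L
    · rw [ENNReal.le_div_iff_mul_le (.inl hM0) (.inl (measure_ne_top μ _))]
      have hcyl : cyl (shift^[n] y) k = cyl (shift^[n] z) k := by
        rw [cyl_add] at hy
        exact cyl_eq_of_mem hy.2
      calc orbitProd E n y * M ≤ orbitProd E n y * (c * orbitProd E k (shift^[n] y)) := by
            rw [hM, ← hcyl]
            gcongr
            exact (hμ _ hyn k).1
        _ = c * orbitProd E (n + k) y := by rw [orbitProd_add]; ring
        _ ≤ c * (c * μ (cyl y (n + k))) := by
            gcongr
            exact (hμ _ hyY _).2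
        _ = c * c * μ (cyl z (n + k)) := by rw [cyl_eq_of_mem hy, mul_assoc]
    · rw [orbitProd_weight_of_notMem φ P hyY hyn]
      exact zero_le
  calc _ ≤ ∫⁻ _ in cyl z (n + k), c * c * μ (cyl z (n + k)) / M ∂(pullback^[n] μ) :=
        lintegral_mono_ae hbound
    _ = c * c * μ (cyl z (n + k)) := by
        rw [setLIntegral_const, hM', ENNReal.div_mul_cancel hM0 (measure_ne_top μ _)]

/-- The argument is dual to the upper bound, but a lower bound on `E_n` fails at inadmissible
points. Cylinders of length at least `n + N` are used, so that gluing makes almost every point of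
the pullback in a cylinder that meets `Y` admissible. -/
lemma le_iterate_dualTransfer (hE : Measurable (weight (sft N L) φ P))
    (hμY : ∀ᵐ x ∂μ, x ∈ sft N L) (hμ : IsGibbsFor (sft N L) (weight (sft N L) φ P) μ c)
    (hc : c ≠ ⊤) (n : ℕ) :
    μ ≤ (c * c) • (dualTransfer (weight (sft N L) φ P))^[n] μ := by
  have hfin : IsFiniteMeasure ((c * c) • (dualTransfer (weight (sft N L) φ P))^[n] μ) := by
    have h1 : IsFiniteMeasure ((c * c) • μ) := μ.smul_finite (ENNReal.mul_ne_top hc hc)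
    have h2 : IsFiniteMeasure ((dualTransfer (weight (sft N L) φ P))^[n] μ) :=
      isFiniteMeasure_of_le _ (iterate_dualTransfer_le hE hμY hμ hc n)
    exact Measure.smul_finite _ (ENNReal.mul_ne_top hc hc)
  set E := weight (sft N L) φ P
  refine measure_le_of_forall_long_cyl_le (n + N) fun z j hj => ?_
  obtain ⟨k, rfl⟩ := Nat.exists_eq_add_of_le ((Nat.le_add_right n N).trans hj)
  by_cases hz : ∃ y ∈ cyl z (n + k), y ∈ sft N L
  swap
  · push Not at hz
    rw [measure_cyl_eq_zero hμY hz]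
    exact zero_le
  obtain ⟨y₀, hy₀, hy₀Y⟩ := hz
  rw [← cyl_eq_of_mem hy₀]
  rw [Measure.smul_apply, smul_eq_mul, iterate_dualTransfer hE,
    withDensity_apply _ (measurableSet_cyl _ _)]
  set M := μ (cyl (shift^[n] y₀) k) with hM
  have hM' : (pullback^[n] μ) (cyl y₀ (n + k)) = M := iterate_pullback_cyl μ y₀ n k
  have hlow : ∀ y ∈ cyl y₀ (n + k), y ∈ sft N L →
      μ (cyl y₀ (n + k)) ≤ c * c * orbitProd E n y * M := fun y hy hyY => by
    have hcyl : cyl (shift^[n] y) k = cyl (shift^[n] y₀) k := by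
      rw [cyl_add] at hy
      exact cyl_eq_of_mem hy.2
    calc μ (cyl y₀ (n + k)) = μ (cyl y (n + k)) := by rw [cyl_eq_of_mem hy]
      _ ≤ c * orbitProd E (n + k) y := (hμ _ hyY _).1
      _ ≤ c * (orbitProd E n y * (c * μ (cyl (shift^[n] y) k))) := by
          rw [orbitProd_add]
          gcongr
          exact (hμ _ (iterate_shift_mem_sft hyY n) _).2
      _ = c * c * orbitProd E n y * M := by rw [hcyl]; ring
  by_cases hM0 : M = 0
  · have := hlow y₀ (self_mem_cyl _ _) hy₀Y
    rw [hM0, mul_zero] at this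
    exact this.trans zero_le
  have hbound : ∀ᵐ y ∂(pullback^[n] μ).restrict (cyl y₀ (n + k)),
      μ (cyl y₀ (n + k)) / M ≤ c * c * orbitProd E n y := by
    filter_upwards [ae_restrict_mem (measurableSet_cyl _ _),
      ae_restrict_of_ae (ae_iterate_pullback (isClosed_sft N L).measurableSet hμY n)] with y hy hyn
    exact ENNReal.div_le_of_le_mul (hlow y hy (mem_sft_of_mem_cyl hy₀Y hy hyn (by omega)))
  rw [← lintegral_const_mul _ (measurable_orbitProd hE n)]
  calc μ (cyl y₀ (n + k))
      = ∫⁻ _ in cyl y₀ (n + k), μ (cyl y₀ (n + k)) / M ∂(pullback^[n] μ) := by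
        rw [setLIntegral_const, hM', ENNReal.div_mul_cancel hM0 (measure_ne_top μ _)]
    _ ≤ _ := lintegral_mono_ae hbound

/-- A Gibbs measure is equivalent to a conformal measure. -/
theorem exists_conformal (hE : Measurable (weight (sft N L) φ P))
    (hμY : ∀ᵐ x ∂μ, x ∈ sft N L) (hμ : IsGibbsFor (sft N L) (weight (sft N L) φ P) μ c)
    (hc : c ≠ ⊤) :
    ∃ ν : Measure (ℕ → S), IsFiniteMeasure ν ∧ μ ≪ ν ∧ ν ≪ μ ∧
      dualTransfer (weight (sft N L) φ P) ν = ν := by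
  have hup := iterate_dualTransfer_le hE hμY hμ hc
  have hlo := le_iterate_dualTransfer hE hμY hμ hc
  set E := weight (sft N L) φ P
  have hcc : c * c ≠ ⊤ := ENNReal.mul_ne_top hc hc
  have hfin1 : IsFiniteMeasure ((c * c) • μ) := μ.smul_finite hcc
  have hfin : IsFiniteMeasure (dualTransfer E μ) := isFiniteMeasure_of_le _ (hup 1)
  have hac : dualTransfer E μ ≪ μ :=
    (Measure.absolutelyContinuous_of_le (hup 1)).trans Measure.smul_absolutelyContinuous
  set Q := (dualTransfer E μ).rnDeriv μ
  have hQ : Measurable Q := Measure.measurable_rnDeriv _ _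
  have hleb : (dualTransfer E μ).HaveLebesgueDecomposition μ :=
    Measure.haveLebesgueDecomposition_of_sigmaFinite _ _
  have hQμ : dualTransfer E μ = μ.withDensity Q := (Measure.withDensity_rnDeriv_eq _ _ hac).symm
  -- With `dualTransfer E μ = Q μ`, the `n`-th iterate has density the orbit product of `Q`, so the
  -- two comparisons bound these products between `1 / (c * c)` and `c * c`, almost everywhere.
  have hit := iterate_dualTransfer_of_eq_withDensity hE hQ hQμ
  have hQn := measurable_orbitProd hQ
  have hQn_le : ∀ᵐ x ∂μ, ∀ n, orbitProd Q n x ≤ c * c := ae_all_iff.mpr fun n =>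
    ae_le_of_forall_setLIntegral_le_of_sigmaFinite (hQn n) fun s hs _ => by
      rw [← withDensity_apply _ hs, ← hit, setLIntegral_const]
      exact hup n s
  have hQn_ge : ∀ᵐ x ∂μ, ∀ n, 1 ≤ c * c * orbitProd Q n x := ae_all_iff.mpr fun n =>
    ae_le_of_forall_setLIntegral_le_of_sigmaFinite measurable_const fun s hs _ => by
      rw [lintegral_const_mul _ (hQn n), ← withDensity_apply (orbitProd Q n) hs, ← hit,
        setLIntegral_const, one_mul]
      exact hlo n s
  -- Since `Q_(n+1) = Q * (Q_n ∘ shift)`, an upper limit in `n` solves `k = Q * (k ∘ shift)`,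
  -- whether or not the products converge.
  let k : (ℕ → S) → ℝ≥0∞ := fun x => Filter.limsup (fun n => orbitProd Q n x) Filter.atTop
  have hk : Measurable k := Measurable.limsup hQn
  have hk_le : ∀ᵐ x ∂μ, k x ≤ c * c := by
    filter_upwards [hQn_le] with x hx
    exact Filter.limsup_le_of_le (h := .of_forall hx)
  have hk_pos : ∀ᵐ x ∂μ, k x ≠ 0 := by
    filter_upwards [hQn_ge] with x hx hx0
    have : (1 : ℝ≥0∞) ≤ c * c * k x := by
      rw [← ENNReal.limsup_const_mul_of_ne_top hcc]
      exact Filter.le_limsup_of_le (h := fun b hb => by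
        obtain ⟨n, hn⟩ := hb.exists
        exact (hx n).trans hn)
    simp [hx0] at this
  have hk_cocycle : ∀ᵐ x ∂μ, (Q * (k ∘ shift)) x = k x := by
    filter_upwards [hQn_le] with x hx
    have hQx : Q x ≠ ⊤ := by
      have := hx 1
      simp only [orbitProd, Finset.prod_range_one, Function.iterate_zero, id] at this
      exact ne_top_of_le_ne_top hcc this
    simp only [Pi.mul_apply, Function.comp_apply, k]
    rw [← ENNReal.limsup_const_mul_of_ne_top hQx,
      ← Filter.limsup_nat_add (fun n => orbitProd Q n x) 1]
    congr 1
    ext n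
    simp [orbitProd_succ, mul_comm]
  refine ⟨μ.withDensity k, ?_, ?_, withDensity_absolutelyContinuous μ k, ?_⟩
  · refine isFiniteMeasure_withDensity ((lintegral_mono_ae hk_le).trans_lt ?_).ne
    rw [lintegral_const]
    exact ENNReal.mul_lt_top hcc.lt_top (measure_lt_top μ _)
  · exact withDensity_absolutelyContinuous' hk.aemeasurable hk_pos
  · rw [dualTransfer_withDensity hE μ hk, hQμ,
      ← withDensity_mul _ hQ (hk.comp measurable_shift)]
    exact withDensity_congr_ae hk_cocycle

end Conformal

/-! ### Bounded distortion. -/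

section Distortion

variable {S : Type*} {N : ℕ} {L : Set (Fin (N + 1) → S)} {φ : (ℕ → S) → ℝ} {ρ : ℝ}

/-- At time `i < n` the two orbits still share at least `m + (n - 1 - i)` letters, so the
differences are dominated by a geometric series and the constant `|K| / (1 - ρ)` does not depend on
`n`. -/
lemma IsHolder.exists_birkhoffSum_le (hρ0 : 0 < ρ) (hρ1 : ρ < 1)
    (h : IsHolder ρ (sft N L) φ) :
    ∃ c : ℝ, 0 ≤ c ∧ ∀ (n m : ℕ), ∀ y ∈ sft N L, ∀ z ∈ sft N L, y ∈ cyl z (n + (m + 1)) →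
      birkhoffSum shift φ n y ≤ birkhoffSum shift φ n z + c * ρ ^ m := by
  obtain ⟨K, hK⟩ := h
  have hpos : 0 < 1 - ρ := by linarith
  refine ⟨|K| * (1 - ρ)⁻¹, by positivity, fun n m y hy z hz hyz => ?_⟩
  have hterm : ∀ i ∈ Finset.range n,
      φ (shift^[i] y) - φ (shift^[i] z) ≤ |K| * ρ ^ m * ρ ^ (n - 1 - i) := fun i hi => by
    have hi' := Finset.mem_range.mp hi
    have hcyl : shift^[i] y ∈ cyl (shift^[i] z) (m + (n - 1 - i)) := fun j hj => by
      rw [iterate_shift_apply, iterate_shift_apply]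
      exact hyz _ (by omega)
    have hd : 0 ≤ seqDist ρ (shift^[i] y) (shift^[i] z) := by
      rw [seqDist]; split_ifs <;> positivity
    calc φ (shift^[i] y) - φ (shift^[i] z) ≤ K * seqDist ρ (shift^[i] y) (shift^[i] z) :=
          (le_abs_self _).trans
            (hK _ (iterate_shift_mem_sft hy i) _ (iterate_shift_mem_sft hz i))
      _ ≤ |K| * ρ ^ (m + (n - 1 - i)) :=
          mul_le_mul (le_abs_self K) (seqDist_le_of_mem_cyl hρ0 hρ1 hcyl) hd (abs_nonneg K)
      _ = |K| * ρ ^ m * ρ ^ (n - 1 - i) := by rw [pow_add, mul_assoc]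
  have hsum : ∑ i ∈ Finset.range n, ρ ^ (n - 1 - i) ≤ (1 - ρ)⁻¹ := by
    rw [Finset.sum_range_reflect (fun j => ρ ^ j) n, ← tsum_geometric_of_lt_one hρ0.le hρ1]
    exact (summable_geometric_of_lt_one hρ0.le hρ1).sum_le_tsum _ fun i _ => by positivity
  have := Finset.sum_le_sum hterm
  rw [Finset.sum_sub_distrib, ← Finset.mul_sum] at this
  have h' : |K| * ρ ^ m * ∑ i ∈ Finset.range n, ρ ^ (n - 1 - i) ≤ |K| * ρ ^ m * (1 - ρ)⁻¹ := by
    gcongr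
  simp only [birkhoffSum]
  linarith

lemma IsHolder.exists_orbitProd_le (hρ0 : 0 < ρ) (hρ1 : ρ < 1)
    (h : IsHolder ρ (sft N L) φ) (P : ℝ) :
    ∃ c : ℝ, 0 ≤ c ∧ ∀ (n m : ℕ), ∀ y ∈ sft N L, ∀ z ∈ sft N L, y ∈ cyl z (n + (m + 1)) →
      orbitProd (weight (sft N L) φ P) n y
        ≤ ENNReal.ofReal (Real.exp (c * ρ ^ m)) * orbitProd (weight (sft N L) φ P) n z := by
  obtain ⟨c, hc, hb⟩ := h.exists_birkhoffSum_le hρ0 hρ1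
  refine ⟨c, hc, fun n m y hy z hz hyz => ?_⟩
  rw [orbitProd_weight_of_mem φ P hy, orbitProd_weight_of_mem φ P hz,
    ← ENNReal.ofReal_mul (Real.exp_pos _).le, ← Real.exp_add]
  refine ENNReal.ofReal_le_ofReal (Real.exp_le_exp.mpr ?_)
  linarith [hb n m y hy z hz hyz]

end Distortion

/-! ### Ratio estimate for a conformal measure. -/

section Regularity

variable {S : Type*} [Finite S] [TopologicalSpace S] [DiscreteTopology S]
  [MeasurableSpace S] [BorelSpace S]
  {N : ℕ} {L : Set (Fin (N + 1) → S)} {E : (ℕ → S) → ℝ≥0∞}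

/-- Sets `B`, `B'` that share their first letters are charged by a conformal measure in almost
the same proportion after any word has been put in front of them. -/
lemma conformal_cross_ratio_le (hE : Measurable E) {ν : Measure (ℕ → S)}
    (hνY : ∀ᵐ x ∂ν, x ∈ sft N L) (hν : dualTransfer E ν = ν) {m : ℕ} (hm : N ≤ m + 1)
    {d : ℝ≥0∞} {n : ℕ}
    (hd : ∀ y ∈ sft N L, ∀ z ∈ sft N L, y ∈ cyl z (n + (m + 1)) →
      orbitProd E n y ≤ d * orbitProd E n z)
    (z : ℕ → S) {B B' : Set (ℕ → S)} (hB : MeasurableSet B) (hB' : MeasurableSet B')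
    (hBz : B ⊆ cyl (shift^[n] z) (m + 1)) (hBz' : B' ⊆ cyl (shift^[n] z) (m + 1)) :
    ν (cyl z n ∩ shift^[n] ⁻¹' B) * ν B'
      ≤ d * d * (ν B * ν (cyl z n ∩ shift^[n] ⁻¹' B')) := by
  have hsub : ∀ {A : Set (ℕ → S)}, A ⊆ cyl (shift^[n] z) (m + 1) →
      cyl z n ∩ shift^[n] ⁻¹' A ⊆ cyl z (n + (m + 1)) := fun hA => by
    rw [cyl_add]
    exact Set.inter_subset_inter_right _ (Set.preimage_mono hA)
  by_cases hz : ∃ y ∈ cyl z (n + (m + 1)), y ∈ sft N L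
  swap
  · push Not at hz
    rw [measure_mono_null (hsub hBz) (measure_cyl_eq_zero hνY hz), zero_mul]
    exact zero_le
  -- The value `E_n` at one admissible reference point `w` replaces the integrand for both sets.
  -- Each replacement costs a factor `d`, and the value itself cancels in the cross product.
  obtain ⟨w, hw, hwY⟩ := hz
  have hmeas : ∀ {A : Set (ℕ → S)}, MeasurableSet A → MeasurableSet (cyl z n ∩ shift^[n] ⁻¹' A) :=
    fun hA => (measurableSet_cyl _ _).inter ((measurable_shift.iterate n) hA)
  have hformula : ∀ {A : Set (ℕ → S)}, MeasurableSet A → ν (cyl z n ∩ shift^[n] ⁻¹' A)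
      = ∫⁻ y in cyl z n ∩ shift^[n] ⁻¹' A, orbitProd E n y ∂(pullback^[n] ν) := fun hA => by
    rw [← withDensity_apply _ (hmeas hA), ← iterate_dualTransfer hE, Function.iterate_fixed hν]
  have hup : ∀ {A : Set (ℕ → S)}, MeasurableSet A → A ⊆ cyl (shift^[n] z) (m + 1) →
      ν (cyl z n ∩ shift^[n] ⁻¹' A) ≤ d * orbitProd E n w * ν A := fun {A} hA hAz => by
    rw [hformula hA]
    calc _ ≤ ∫⁻ _ in cyl z n ∩ shift^[n] ⁻¹' A, d * orbitProd E n w ∂(pullback^[n] ν) := by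
          refine lintegral_mono_ae ?_
          filter_upwards [ae_restrict_mem (hmeas hA),
            ae_restrict_of_ae (ae_iterate_pullback (isClosed_sft N L).measurableSet hνY n)]
            with y hy hyn
          have hyw : y ∈ cyl w (n + (m + 1)) := cyl_eq_of_mem hw ▸ hsub hAz hy
          exact hd y (mem_sft_of_mem_cyl hwY hyw hyn hm) w hwY hyw
      _ = d * orbitProd E n w * ν A := by
          rw [setLIntegral_const, iterate_pullback_cyl_inter _ _ _ hA]
  have hlo : ∀ {A : Set (ℕ → S)}, MeasurableSet A → A ⊆ cyl (shift^[n] z) (m + 1) →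
      orbitProd E n w * ν A ≤ d * ν (cyl z n ∩ shift^[n] ⁻¹' A) := fun {A} hA hAz => by
    rw [hformula hA, ← lintegral_const_mul _ (measurable_orbitProd hE n)]
    calc _ = ∫⁻ _ in cyl z n ∩ shift^[n] ⁻¹' A, orbitProd E n w ∂(pullback^[n] ν) := by
          rw [setLIntegral_const, iterate_pullback_cyl_inter _ _ _ hA]
      _ ≤ _ := by
          refine lintegral_mono_ae ?_
          filter_upwards [ae_restrict_mem (hmeas hA),
            ae_restrict_of_ae (ae_iterate_pullback (isClosed_sft N L).measurableSet hνY n)]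
            with y hy hyn
          have hyw : y ∈ cyl w (n + (m + 1)) := cyl_eq_of_mem hw ▸ hsub hAz hy
          have hwy : w ∈ cyl y (n + (m + 1)) := cyl_eq_of_mem hyw ▸ self_mem_cyl w _
          exact hd w hwY y (mem_sft_of_mem_cyl hwY hyw hyn hm) hwy
  calc ν (cyl z n ∩ shift^[n] ⁻¹' B) * ν B' ≤ d * orbitProd E n w * ν B * ν B' := by
        gcongr
        exact hup hB hBz
    _ = d * ν B * (orbitProd E n w * ν B') := by ring
    _ ≤ d * ν B * (d * ν (cyl z n ∩ shift^[n] ⁻¹' B')) := by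
        exact mul_le_mul_right (hlo hB' hBz') _
    _ = _ := by ring

end Regularity

/-! ### From the conformal to the invariant measure. -/

section Invariant

variable {S : Type*}

lemma exists_shift_iterate_preimage_inter_cyl (x z : ℕ → S) (l n : ℕ) :
    ∃ w : ℕ → S, shift^[l + n] w = shift^[n] z ∧ ∀ B : Set (ℕ → S),
      cyl x l ∩ shift^[l] ⁻¹' (cyl z n ∩ shift^[n] ⁻¹' B)
        = cyl w (l + n) ∩ shift^[l + n] ⁻¹' B := by
  refine ⟨fun i => if i < l then x i else z (i - l), ?_, fun B => ?_⟩
  · ext i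
    simp only [iterate_shift_apply]
    rw [if_neg (by omega)]
    congr 1
    omega
  · ext y
    simp only [cyl, Set.mem_inter_iff, Set.mem_ofPred_eq, Set.mem_preimage,
      ← Function.iterate_add_apply, iterate_shift_apply]
    rw [add_comm n l]
    constructor
    · rintro ⟨h1, h2, h3⟩
      refine ⟨fun i hi => ?_, h3⟩
      split_ifs with hil
      · exact h1 i hil
      · simpa [Nat.sub_add_cancel (not_lt.mp hil)] using h2 (i - l) (by omega)
    · rintro ⟨h1, h2⟩
      refine ⟨fun i hi => ?_, fun i hi => ?_, h2⟩
      · simpa [hi] using h1 i (by omega)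
      · simpa using h1 (i + l) (by omega)

variable [MeasurableSpace S]

lemma cyl_subset_of_measurableSet_piLE {n : ℕ} {U : Set (ℕ → S)}
    (hU : MeasurableSet[Filtration.piLE (X := fun _ : ℕ => S) n] U) {x : ℕ → S} (hx : x ∈ U) :
    cyl x (n + 1) ⊆ U := by
  obtain ⟨V, -, rfl⟩ := hU
  intro y hy
  have : Preorder.restrictLe (π := fun _ : ℕ => S) n y = Preorder.restrictLe n x := by
    ext i
    exact hy i (Nat.lt_succ_of_le i.2)
  simpa only [Set.mem_preimage, this] using hx

lemma iSup_piLE : ⨆ n, (Filtration.piLE (X := fun _ : ℕ => S) n) = MeasurableSpace.pi := by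
  refine le_antisymm (iSup_le fun n => Filtration.le _ n) (iSup_le fun i => ?_)
  refine le_trans ?_ (le_iSup _ i)
  rintro _ ⟨V, hV, rfl⟩
  exact ⟨(fun f => f ⟨i, le_refl i⟩) ⁻¹' V, measurable_pi_apply _ hV, rfl⟩

/-- An absolutely continuous measure is approximated in total variation by measures with a
density that depends on finitely many letters. -/
lemma exists_prefix_density {μ ν : Measure (ℕ → S)} [IsFiniteMeasure μ] [IsFiniteMeasure ν]
    (h : μ ≪ ν) {ε : ℝ≥0∞} (hε : 0 < ε) :
    ∃ (n : ℕ) (f : (ℕ → S) → ℝ≥0∞), Measurable[Filtration.piLE (X := fun _ : ℕ => S) n] f ∧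
      ∀ D, MeasurableSet D → μ D ≤ (∫⁻ x in D, f x ∂ν) + ε ∧ ∫⁻ x in D, f x ∂ν ≤ μ D + ε := by
  have hleb : μ.HaveLebesgueDecomposition ν := Measure.haveLebesgueDecomposition_of_sigmaFinite _ _
  let g : (ℕ → S) → ℝ := fun x => (μ.rnDeriv ν x).toReal
  have hg : Integrable g ν := Measure.integrable_toReal_rnDeriv
  have hgm : StronglyMeasurable[⨆ n, (Filtration.piLE (X := fun _ : ℕ => S) n)] g := by
    rw [iSup_piLE]
    exact (Measure.measurable_rnDeriv μ ν).ennreal_toReal.stronglyMeasurable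
  have hμ : ∀ D, MeasurableSet D → μ D = ∫⁻ x in D, ENNReal.ofReal (g x) ∂ν := fun D hD => by
    rw [← Measure.setLIntegral_rnDeriv h D]
    refine lintegral_congr_ae (ae_restrict_of_ae ?_)
    filter_upwards [Measure.rnDeriv_lt_top μ ν] with x hx
    exact (ENNReal.ofReal_toReal hx.ne).symm
  -- Lévy's upward theorem in `L¹`: the density is approximated by its conditional expectations on
  -- the initial letters. Truncating these at `0` does not increase the error.
  obtain ⟨n, hn⟩ := ((hg.tendsto_eLpNorm_condExp hgm).eventually_le_const hε).exists
  have hmeas : StronglyMeasurable[Filtration.piLE (X := fun _ : ℕ => S) n]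
      (ν[g | Filtration.piLE (X := fun _ : ℕ => S) n]) := stronglyMeasurable_condExp
  set k := ν[g | Filtration.piLE (X := fun _ : ℕ => S) n]
  have hkm : Measurable k := (hmeas.mono (Filtration.le _ n)).measurable
  rw [eLpNorm_one_eq_lintegral_enorm] at hn
  have hle : ∀ a b : ℝ, ENNReal.ofReal a ≤ ENNReal.ofReal b + ‖a - b‖ₑ := fun a b => by
    rw [Real.enorm_eq_ofReal_abs]
    refine le_trans (ENNReal.ofReal_le_ofReal ?_) ENNReal.ofReal_add_le
    linarith [le_abs_self (a - b)]
  have hgm' : Measurable g := (Measure.measurable_rnDeriv μ ν).ennreal_toReal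
  refine ⟨n, fun x => ENNReal.ofReal (k x), hmeas.measurable.ennreal_ofReal, fun D hD => ?_⟩
  have hD' : ∫⁻ x in D, ‖k x - g x‖ₑ ∂ν ≤ ε := (setLIntegral_le_lintegral _ _).trans hn
  rw [hμ D hD]
  constructor
  · calc _ ≤ ∫⁻ x in D, (ENNReal.ofReal (k x) + ‖k x - g x‖ₑ) ∂ν := by
          refine lintegral_mono fun x => ?_
          rw [← enorm_neg, neg_sub]
          exact hle _ _
      _ ≤ _ := by
          rw [lintegral_add_left hkm.ennreal_ofReal]
          gcongr
  · calc _ ≤ ∫⁻ x in D, (ENNReal.ofReal (g x) + ‖k x - g x‖ₑ) ∂ν :=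
          lintegral_mono fun x => hle _ _
      _ ≤ _ := by
          rw [lintegral_add_left hgm'.ennreal_ofReal]
          gcongr

variable [Finite S] [MeasurableSingletonClass S]

/-- The regularity of a conformal measure passes to an equivalent invariant measure. -/
lemma invariant_cross_ratio_le {μ ν : Measure (ℕ → S)} [IsFiniteMeasure μ] [IsFiniteMeasure ν]
    (hμν : μ ≪ ν) (hinv : MeasurePreserving shift μ μ) {d : ℝ≥0∞} (hd : d ≠ ⊤) {m : ℕ}
    (h : ∀ (n : ℕ) (z : ℕ → S) (B B' : Set (ℕ → S)), MeasurableSet B → MeasurableSet B' →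
      B ⊆ cyl (shift^[n] z) (m + 1) → B' ⊆ cyl (shift^[n] z) (m + 1) →
      ν (cyl z n ∩ shift^[n] ⁻¹' B) * ν B' ≤ d * (ν B * ν (cyl z n ∩ shift^[n] ⁻¹' B')))
    (n : ℕ) (z : ℕ → S) {B B' : Set (ℕ → S)} (hB : MeasurableSet B) (hB' : MeasurableSet B')
    (hBz : B ⊆ cyl (shift^[n] z) (m + 1)) (hBz' : B' ⊆ cyl (shift^[n] z) (m + 1)) :
    μ (cyl z n ∩ shift^[n] ⁻¹' B) * ν B' ≤ d * (ν B * μ (cyl z n ∩ shift^[n] ⁻¹' B')) := by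
  set D := cyl z n ∩ shift^[n] ⁻¹' B with hD
  set D' := cyl z n ∩ shift^[n] ⁻¹' B' with hD'
  have hDm : MeasurableSet D := (measurableSet_cyl _ _).inter ((measurable_shift.iterate n) hB)
  have hDm' : MeasurableSet D' := (measurableSet_cyl _ _).inter ((measurable_shift.iterate n) hB')
  have approx : ∀ ε : ℝ≥0∞, 0 < ε → μ D * ν B' ≤ d * (ν B * μ D') + ε * (d * ν B + ν B') := by
    intro ε hε
    obtain ⟨l, f, hf, hfD⟩ := exists_prefix_density hμν hε
    have hsm : Measurable (shift^[l + 1] : (ℕ → S) → ℕ → S) := measurable_shift.iterate (l + 1)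
    have hint : (∫⁻ x in shift^[l + 1] ⁻¹' D, f x ∂ν) * ν B'
        ≤ d * (ν B * ∫⁻ x in shift^[l + 1] ⁻¹' D', f x ∂ν) := by
      -- The density `f` depends on the first `l + 1` letters only. Fixing these letters merely
      -- lengthens the word in front of `B` and `B'`, so `h` compares `α` and `β` on each cylinder
      -- with the same constants `ν B`, `ν B'`. Hence they compare on the σ-algebra for which `f` is
      -- measurable.
      let α := ν B' • ν.restrict (shift^[l + 1] ⁻¹' D)
      let β := (d * ν B) • ν.restrict (shift^[l + 1] ⁻¹' D')
      have hcyl : ∀ x, α (cyl x (l + 1)) ≤ β (cyl x (l + 1)) := fun x => by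
        simp only [α, β, Measure.smul_apply, smul_eq_mul,
          Measure.restrict_apply (measurableSet_cyl x (l + 1)), hD, hD']
        obtain ⟨w, hw, hwB⟩ := exists_shift_iterate_preimage_inter_cyl x z (l + 1) n
        rw [hwB, hwB, mul_comm, mul_assoc]
        exact h (l + 1 + n) w B B' hB hB' (hw ▸ hBz) (hw ▸ hBz')
      have hm := Filtration.le (Filtration.piLE (X := fun _ : ℕ => S)) l
      have htrim : α.trim hm ≤ β.trim hm := Measure.le_intro fun U hU _ => by
        rw [trim_measurableSet_eq hm hU, trim_measurableSet_eq hm hU]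
        exact measure_le_of_forall_cyl_le hcyl
          fun x hx => cyl_subset_of_measurableSet_piLE hU hx
      have := lintegral_mono' htrim (le_refl f)
      rw [lintegral_trim hm hf, lintegral_trim hm hf, lintegral_smul_measure,
        lintegral_smul_measure, smul_eq_mul, smul_eq_mul] at this
      rwa [mul_comm, ← mul_assoc]
    have hμD : μ D = μ (shift^[l + 1] ⁻¹' D) :=
      ((hinv.iterate (l + 1)).measure_preimage hDm.nullMeasurableSet).symm
    have hμD' : μ D' = μ (shift^[l + 1] ⁻¹' D') :=
      ((hinv.iterate (l + 1)).measure_preimage hDm'.nullMeasurableSet).symm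
    calc μ D * ν B' ≤ ((∫⁻ x in shift^[l + 1] ⁻¹' D, f x ∂ν) + ε) * ν B' := by
          rw [hμD]
          gcongr
          exact (hfD _ (hsm hDm)).1
      _ ≤ d * (ν B * ∫⁻ x in shift^[l + 1] ⁻¹' D', f x ∂ν) + ε * ν B' := by
          rw [add_mul]
          gcongr
      _ ≤ d * (ν B * (μ D' + ε)) + ε * ν B' := by
          rw [hμD']
          gcongr
          exact (hfD _ (hsm hDm')).2
      _ = _ := by ring
  set M := d * ν B + ν B'
  have hM : M ≠ ⊤ := ENNReal.add_ne_top.mpr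
    ⟨ENNReal.mul_ne_top hd (measure_ne_top ν B), measure_ne_top ν B'⟩
  refine ENNReal.le_of_forall_pos_le_add fun ε hε _ => ?_
  have hM1 : M + 1 ≠ ⊤ := ENNReal.add_ne_top.mpr ⟨hM, ENNReal.one_ne_top⟩
  -- Dividing by `M + 1` rather than `M` covers the case `M = 0`.
  refine (approx (ε / (M + 1)) (ENNReal.div_pos (by exact_mod_cast hε.ne') hM1)).trans ?_
  gcongr
  calc (ε : ℝ≥0∞) / (M + 1) * M ≤ ε / (M + 1) * (M + 1) := by gcongr; exact le_self_add
    _ = ε := ENNReal.div_mul_cancel (by simp) hM1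

end Invariant

/-! ### Ratio estimate for the invariant Gibbs measure. -/

section CrossRatio

variable {S : Type*} [Finite S] [TopologicalSpace S] [DiscreteTopology S]
  [MeasurableSpace S] [BorelSpace S]
  {N : ℕ} {L : Set (Fin (N + 1) → S)} {φ : (ℕ → S) → ℝ} {ρ : ℝ} {μ : Measure (ℕ → S)}

/-- For an invariant Gibbs measure, the conditional probability of the continuation of a word
depends on the letters before the last `m + 1` ones only up to a factor `exp (t * ρ ^ m)`. -/
theorem IsInvariantGibbs.exists_cross_ratio_le (hρ0 : 0 < ρ) (hρ1 : ρ < 1)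
    (hφ : IsHolder ρ (sft N L) φ) (hμ : IsInvariantGibbs (sft N L) φ μ) :
    ∃ t : ℝ, 0 ≤ t ∧ ∀ m : ℕ, N ≤ m + 1 → ∀ (n n' : ℕ) (z z' : ℕ → S) (B : Set (ℕ → S)),
      MeasurableSet B → cyl (shift^[n'] z') (m + 1) = cyl (shift^[n] z) (m + 1) →
      B ⊆ cyl (shift^[n] z) (m + 1) →
      μ (cyl z n ∩ shift^[n] ⁻¹' B) * μ (cyl z' (n' + (m + 1)))
        ≤ ENNReal.ofReal (Real.exp (t * ρ ^ m))
          * (μ (cyl z' n' ∩ shift^[n'] ⁻¹' B) * μ (cyl z (n + (m + 1)))) := by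
  have := hμ.prob
  obtain ⟨P, K, hK, hGibbs⟩ := hμ.gibbs.exists_isGibbsFor
  have hE : Measurable (weight (sft N L) φ P) :=
    measurable_weight (isClosed_sft N L) (hφ.continuousOn hρ0 hρ1) P
  obtain ⟨ν, hνfin, hμν, hνμ, hν⟩ := exists_conformal hE hμ.carried hGibbs hK
  obtain ⟨c, hc, hdist⟩ := hφ.exists_orbitProd_le hρ0 hρ1 P
  refine ⟨4 * c, by positivity, fun m hm n n' z z' B hB hzz' hBz => ?_⟩
  set d := ENNReal.ofReal (Real.exp (c * ρ ^ m)) with hd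
  have hdd : d * d ≠ ⊤ := ENNReal.mul_ne_top ENNReal.ofReal_ne_top ENNReal.ofReal_ne_top
  have hd4 : ENNReal.ofReal (Real.exp (4 * c * ρ ^ m)) = d * d * (d * d) := by
    simp only [hd, ← ENNReal.ofReal_mul (Real.exp_pos _).le, ← Real.exp_add]
    congr 2
    ring
  have key := invariant_cross_ratio_le hμν hμ.invariant hdd
    fun n z B B' hB hB' hBz hBz' => conformal_cross_ratio_le hE (hνμ.ae_le hμ.carried) hν hm
      (fun y hy z hz hyz => hdist n m y hy z hz hyz) z hB hB' hBz hBz'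
  set B₀ := cyl (shift^[n] z) (m + 1) with hB₀
  have hB₀m : MeasurableSet B₀ := measurableSet_cyl _ _
  -- Both pasts are compared with the same ratio of `ν B` to `ν B₀`, where `B₀` is the whole
  -- cylinder. Each comparison costs `d * d`, hence the constant `4 * c`; the factor `ν B` is
  -- absorbed and `ν B₀` is cancelled at the end.
  have h1 := key n z hB hB₀m hBz subset_rfl
  have h2 := key n' z' hB₀m hB hzz'.ge (hBz.trans hzz'.ge)
  rw [cyl_add z, cyl_add z', hzz', hd4]
  set a := μ (cyl z n ∩ shift^[n] ⁻¹' B)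
  set a₀ := μ (cyl z n ∩ shift^[n] ⁻¹' B₀)
  set b := μ (cyl z' n' ∩ shift^[n'] ⁻¹' B)
  set b₀ := μ (cyl z' n' ∩ shift^[n'] ⁻¹' B₀) with hb₀
  by_cases h0 : ν B₀ = 0
  · have : b₀ = 0 := by
      refine measure_mono_null Set.inter_subset_right ?_
      rw [(hμ.invariant.iterate n').measure_preimage hB₀m.nullMeasurableSet]
      exact hμν h0
    simp [this]
  refine (ENNReal.mul_le_mul_iff_right h0 (measure_ne_top ν B₀)).mp ?_
  calc ν B₀ * (a * b₀) = a * ν B₀ * b₀ := by ring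
    _ ≤ d * d * (ν B * a₀) * b₀ := by gcongr
    _ = d * d * a₀ * (b₀ * ν B) := by ring
    _ ≤ d * d * a₀ * (d * d * (ν B₀ * b)) := mul_le_mul_right h2 _
    _ = ν B₀ * (d * d * (d * d) * (b * a₀)) := by ring

end CrossRatio

/-! ### Conditioning on a variable with finitely many values. -/

section FiniteConditioning

variable {Ω F : Type*} [MeasurableSpace Ω] [Finite F] [MeasurableSpace F]
  [MeasurableSingletonClass F] {μ : Measure Ω} [IsFiniteMeasure μ]

/-- The elementary formula for the conditional probability given a random variable with finitely
many values. -/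
lemma condExp_comap_finite {r : Ω → F} (hr : Measurable r) {A : Set Ω} (hA : MeasurableSet A) :
    (fun x => μ.real (A ∩ r ⁻¹' {r x}) / μ.real (r ⁻¹' {r x}))
      =ᵐ[μ] μ⟦A | MeasurableSpace.comap r inferInstance⟧ := by
  classical
  have := Fintype.ofFinite F
  let G : F → ℝ := fun v => μ.real (A ∩ r ⁻¹' {v}) / μ.real (r ⁻¹' {v})
  have hG : Measurable G := measurable_of_finite G
  have hint : Integrable (G ∘ r) μ :=
    (Integrable.of_finite (μ := μ.map r) (f := G)).comp_measurable hr
  refine ae_eq_condExp_of_forall_setIntegral_eq (f := A.indicator fun _ => (1 : ℝ)) hr.comap_le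
    ((integrable_const 1).indicator hA) (fun s _ _ => hint.integrableOn) ?_ ?_
  · rintro _ ⟨V, hV, rfl⟩ -
    change ∫ x in r ⁻¹' V, G (r x) ∂μ = _
    rw [← setIntegral_map hV hG.aestronglyMeasurable hr.aemeasurable,
      setIntegral_indicator hA, setIntegral_const, smul_eq_mul, mul_one]
    have hVfin : V = ↑(V.toFinset) := by simp
    have hsum : μ.real (r ⁻¹' V ∩ A) = ∑ v ∈ V.toFinset, μ.real (A ∩ r ⁻¹' {v}) := by
      rw [← measureReal_biUnion_finset]
      · congr 1
        ext x
        simp [and_comm]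
      · intro v _ w _ hvw
        exact ((Set.disjoint_singleton.mpr hvw).preimage r).mono Set.inter_subset_right
          Set.inter_subset_right
      · exact fun v _ => hA.inter (hr (measurableSet_singleton v))
    rw [hsum]
    conv_lhs => rw [hVfin]
    rw [setIntegral_finset _ Integrable.of_finite.integrableOn]
    refine Finset.sum_congr rfl fun v _ => ?_
    rw [map_measureReal_apply hr (measurableSet_singleton v), smul_eq_mul]
    -- On null atoms the quotient takes the default value `0`, consistent with the vanishing
    -- numerator.
    by_cases h0 : μ.real (r ⁻¹' {v}) = 0
    · have : μ.real (A ∩ r ⁻¹' {v}) = 0 :=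
        le_antisymm (h0 ▸ measureReal_mono Set.inter_subset_right) measureReal_nonneg
      simp [h0, this]
    · exact mul_div_cancel₀ _ h0
  · exact (hG.comp (comap_measurable r)).aestronglyMeasurable

end FiniteConditioning

/-! ### Two-sided sequences and a version of the conditional probabilities. -/

section TwoSided

variable {S : Type*}

/-- The one-sided sequence that starts at the coordinate `-n` of a two-sided one. -/
def futureFrom (n : ℕ) (x : ℤ → S) : ℕ → S := fun i => x ((i : ℤ) - n)

lemma shift_iterate_futureFrom {m n : ℕ} (h : m ≤ n) (x : ℤ → S) :
    shift^[n - m] (futureFrom n x) = futureFrom m x := by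
  ext i
  rw [iterate_shift_apply, futureFrom, futureFrom]
  congr 1
  omega

lemma futureFrom_mem_sft {N : ℕ} {L : Set (Fin (N + 1) → S)} {x : ℤ → S} (hx : x ∈ sftZ N L)
    (n : ℕ) : futureFrom n x ∈ sft N L := by
  intro i
  convert hx ((i : ℤ) - n) using 2
  rw [futureFrom]
  congr 1
  push_cast
  ring

lemma mem_sftZ_of_forall_futureFrom {N : ℕ} {L : Set (Fin (N + 1) → S)} {x : ℤ → S}
    (h : ∀ n, futureFrom n x ∈ sft N L) : x ∈ sftZ N L := by
  intro i
  convert h i.natAbs (i + i.natAbs).toNat using 2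
  rw [futureFrom]
  congr 1
  omega

/-- The two-sided sequences that agree with `x` on the coordinates `-n, …, 0`. -/
def pastCyl (x : ℤ → S) (n : ℕ) : Set (ℤ → S) := futureFrom n ⁻¹' cyl (futureFrom n x) (n + 1)

lemma mem_pastCyl {x y : ℤ → S} {n : ℕ} :
    y ∈ pastCyl x n ↔ ∀ i : ℤ, -(n : ℤ) ≤ i → i ≤ 0 → y i = x i := by
  simp only [pastCyl, cyl, futureFrom, Set.mem_preimage, Set.mem_ofPred_eq]
  constructor
  · intro h i hi hi'
    have := h (i + n).toNat (by omega)
    rwa [show (((i + n).toNat : ℕ) : ℤ) - n = i by omega] at this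
  · exact fun h i hi => h _ (by omega) (by omega)

lemma pastCyl_eq_preimage (x : ℤ → S) (n : ℕ) :
    pastCyl x n = (fun (y : ℤ → S) (i : Set.Icc (-(n : ℤ)) 0) => y i) ⁻¹'
      {fun i : Set.Icc (-(n : ℤ)) 0 => x i} := by
  ext y
  rw [mem_pastCyl, Set.mem_preimage, Set.mem_singleton_iff, funext_iff]
  exact ⟨fun h i => h i i.2.1 i.2.2, fun h i hi hi' => h ⟨i, hi, hi'⟩⟩

variable [MeasurableSpace S]

lemma measurable_futureFrom (n : ℕ) : Measurable (futureFrom n : (ℤ → S) → ℕ → S) :=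
  measurable_pi_lambda _ fun _ => measurable_pi_apply _

lemma coordSigma_eq_comap (I : Set ℤ) : coordSigma (S := S) I
    = MeasurableSpace.comap (fun (x : ℤ → S) (i : I) => x i) inferInstance := by
  rw [coordSigma, MeasurableSpace.comap_process_pi, iSup_subtype']

lemma coordSigma_le (I : Set ℤ) : coordSigma (S := S) I ≤ MeasurableSpace.pi :=
  iSup₂_le fun i _ => (measurable_pi_apply i).comap_le

lemma coordSigma_mono {I J : Set ℤ} (h : I ⊆ J) : coordSigma (S := S) I ≤ coordSigma J :=
  biSup_mono h

lemma IsFutureEvent.measurableSet {A : Set (ℤ → S)} (hA : IsFutureEvent A) : MeasurableSet A := by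
  obtain ⟨r, hr⟩ := hA
  exact coordSigma_le _ _ hr

lemma IsFutureEvent.exists_eq_preimage {A : Set (ℤ → S)} (hA : IsFutureEvent A) (m : ℕ) :
    ∃ B, MeasurableSet B ∧ futureFrom m ⁻¹' B = A := by
  obtain ⟨r, hr⟩ := hA
  suffices h : coordSigma (Set.Icc 1 (r : ℤ)) ≤ MeasurableSpace.comap (futureFrom (S := S) m)
      inferInstance from h A hr
  refine iSup₂_le fun i hi => ?_
  have h : (fun x : ℤ → S => x i) = (fun y : ℕ → S => y (i + m).toNat) ∘ futureFrom m := by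
    ext x
    simp only [Function.comp_apply, futureFrom]
    congr 1
    have := hi.1
    omega
  rw [h, ← MeasurableSpace.comap_comp]
  exact MeasurableSpace.comap_mono (measurable_pi_apply _).comap_le

lemma countable_isFutureEvent [Finite S] :
    {A : Set (ℤ → S) | IsFutureEvent A}.Countable := by
  have : {A : Set (ℤ → S) | IsFutureEvent A} ⊆ ⋃ r : ℕ, Set.range
      fun V : Set (Set.Icc 1 (r : ℤ) → S) =>
        (fun (x : ℤ → S) (i : Set.Icc 1 (r : ℤ)) => x i) ⁻¹' V := by
    rintro A ⟨r, hr⟩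
    rw [coordSigma_eq_comap] at hr
    obtain ⟨V, -, hV⟩ := hr
    exact Set.mem_iUnion.mpr ⟨r, V, hV⟩
  exact (Set.countable_iUnion fun r => Set.countable_range _).mono this

/-- The filtration of the coordinates `-n, …, 0`. -/
def pastFiltration (S : Type*) [MeasurableSpace S] :
    Filtration ℕ (MeasurableSpace.pi : MeasurableSpace (ℤ → S)) where
  seq n := coordSigma (Set.Icc (-(n : ℤ)) 0)
  mono' _ _ h := coordSigma_mono (Set.Icc_subset_Icc_left (by omega))
  le' _ := coordSigma_le _

lemma iSup_pastFiltration : ⨆ n, pastFiltration S n = past S := by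
  refine le_antisymm (iSup_le fun n => coordSigma_mono fun i hi => hi.2)
    (iSup₂_le fun i hi => ?_)
  refine le_trans ?_ (le_iSup _ i.natAbs)
  refine le_biSup (fun i => MeasurableSpace.comap (fun x : ℤ → S => x i) inferInstance) ?_
  simp only [Set.mem_Iic] at hi
  exact ⟨by omega, hi⟩

/-- The conditional probability of `A` given the coordinates `-n, …, 0`. -/
def pastRatio (μZ : Measure (ℤ → S)) (A : Set (ℤ → S)) (n : ℕ) (x : ℤ → S) : ℝ :=
  μZ.real (A ∩ pastCyl x n) / μZ.real (pastCyl x n)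

lemma pastRatio_nonneg (μZ : Measure (ℤ → S)) (A : Set (ℤ → S)) (n : ℕ) (x : ℤ → S) :
    0 ≤ pastRatio μZ A n x := by
  unfold pastRatio
  positivity

lemma pastRatio_le_one (μZ : Measure (ℤ → S)) [IsFiniteMeasure μZ] (A : Set (ℤ → S)) (n : ℕ)
    (x : ℤ → S) : pastRatio μZ A n x ≤ 1 :=
  div_le_one_of_le₀ (measureReal_mono Set.inter_subset_right) measureReal_nonneg

/-- A version of the conditional probability of `A` given the past: the upper limit of the
conditional probabilities given finitely many coordinates. -/
def pastProb (μZ : Measure (ℤ → S)) (A : Set (ℤ → S)) (x : ℤ → S) : ℝ :=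
  Filter.limsup (fun n => pastRatio μZ A n x) Filter.atTop

section Versions

variable {μZ : Measure (ℤ → S)} {A : Set (ℤ → S)}

variable [Finite S] [MeasurableSingletonClass S]

lemma measurable_pastRatio (μZ : Measure (ℤ → S)) (A : Set (ℤ → S)) (n : ℕ) :
    Measurable[past S] (pastRatio μZ A n) := by
  let r := fun (y : ℤ → S) (i : Set.Icc (-(n : ℤ)) 0) => y i
  let G : (Set.Icc (-(n : ℤ)) 0 → S) → ℝ := fun v =>
    μZ.real (A ∩ r ⁻¹' {v}) / μZ.real (r ⁻¹' {v})
  have h : pastRatio μZ A n = G ∘ r := by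
    ext x
    simp only [pastRatio, pastCyl_eq_preimage, Function.comp_apply, G, r]
  have hm : Measurable[coordSigma (Set.Icc (-(n : ℤ)) 0)] (pastRatio μZ A n) := by
    rw [h, coordSigma_eq_comap]
    exact (measurable_of_finite G).comp (comap_measurable r)
  exact hm.mono (coordSigma_mono fun i hi => hi.2) le_rfl

lemma stronglyMeasurable_pastProb (μZ : Measure (ℤ → S)) (A : Set (ℤ → S)) :
    StronglyMeasurable[past S] (pastProb μZ A) :=
  (Measurable.limsup fun n => measurable_pastRatio μZ A n).stronglyMeasurable

/-- The ratios are the martingale of conditional probabilities given the coordinates `-n, …, 0`; by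
Lévy's upward theorem they converge almost surely, so the upper limit is a limit there. -/
lemma pastProb_ae_eq [IsFiniteMeasure μZ] (hA : MeasurableSet A) :
    pastProb μZ A =ᵐ[μZ] μZ⟦A | past S⟧ := by
  have h1 : ∀ᵐ x ∂μZ, ∀ n, pastRatio μZ A n x = (μZ⟦A | pastFiltration S n⟧) x := by
    refine ae_all_iff.mpr fun n => ?_
    have hr : Measurable fun (y : ℤ → S) (i : Set.Icc (-(n : ℤ)) 0) => y i :=
      measurable_pi_lambda _ fun _ => measurable_pi_apply _
    have := condExp_comap_finite (μ := μZ) hr hA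
    rw [← coordSigma_eq_comap] at this
    filter_upwards [this] with x hx
    rw [pastRatio, pastCyl_eq_preimage]
    exact hx
  have h2 := tendsto_ae_condExp (μ := μZ) (ℱ := pastFiltration S) (A.indicator fun _ => (1 : ℝ))
  rw [iSup_pastFiltration] at h2
  filter_upwards [h1, h2] with x hx hlim
  simp only [← hx] at hlim
  exact hlim.limsup_eq

lemma isCondProbGivenPast_pastProb [IsFiniteMeasure μZ] :
    IsCondProbGivenPast μZ (pastProb μZ) :=
  fun A hA => ⟨stronglyMeasurable_pastProb μZ A, pastProb_ae_eq hA.measurableSet⟩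

end Versions

lemma pastProb_nonneg (μZ : Measure (ℤ → S)) [IsFiniteMeasure μZ] (A : Set (ℤ → S))
    (x : ℤ → S) : 0 ≤ pastProb μZ A x :=
  Filter.le_limsup_of_frequently_le (Filter.Frequently.of_forall fun n => pastRatio_nonneg μZ A n x)
    (Filter.isBoundedUnder_of ⟨1, fun n => pastRatio_le_one μZ A n x⟩)

lemma pastProb_le_mul {μZ : Measure (ℤ → S)} [IsFiniteMeasure μZ] {A : Set (ℤ → S)}
    {x y : ℤ → S} {D : ℝ} (hD : 0 < D) {m : ℕ}
    (h : ∀ n ≥ m, ∀ n' ≥ m, pastRatio μZ A n x ≤ D * pastRatio μZ A n' y) :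
    pastProb μZ A x ≤ D * pastProb μZ A y := by
  rw [mul_comm, ← div_le_iff₀ hD]
  refine Filter.le_limsup_of_frequently_le (Filter.Eventually.frequently ?_)
    (Filter.isBoundedUnder_of ⟨1, fun n => pastRatio_le_one μZ A n y⟩)
  filter_upwards [Filter.eventually_ge_atTop m] with n' hn'
  rw [div_le_iff₀ hD, mul_comm]
  refine Filter.limsup_le_of_le (Filter.isCoboundedUnder_le_of_le _
    fun n => pastRatio_nonneg μZ A n x) ?_
  filter_upwards [Filter.eventually_ge_atTop m] with n hn
  exact h n hn n' hn'

namespace IsBilateralExtension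

variable {μ : Measure (ℕ → S)} {μZ : Measure (ℤ → S)}

lemma isProbabilityMeasure [IsProbabilityMeasure μ] (h : IsBilateralExtension μ μZ) :
    IsProbabilityMeasure μZ := by
  constructor
  have := h.proj.measure_preimage (s := Set.univ) MeasurableSet.univ.nullMeasurableSet
  simpa using this

lemma measurePreserving_futureFrom (h : IsBilateralExtension μ μZ) (n : ℕ) :
    MeasurePreserving (futureFrom n) μZ μ := by
  refine ⟨measurable_futureFrom n, ?_⟩
  have hcomp : (futureFrom n : (ℤ → S) → ℕ → S) ∘ shiftZ^[n] = futureProj := by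
    have hit : ∀ (n : ℕ) (x : ℤ → S) (i : ℤ), (shiftZ^[n] x) i = x (i + n) := fun n => by
      induction n with
      | zero => simp
      | succ n ih =>
        intro x i
        rw [Function.iterate_succ_apply, ih]
        simp only [shiftZ]
        congr 1
        push_cast
        ring
    ext x i
    simp [futureFrom, futureProj, hit]
  have hinv := h.invariant.iterate n
  rw [← hinv.map_eq, Measure.map_map (measurable_futureFrom n) hinv.measurable, hcomp,
    h.proj.map_eq]

lemma ae_mem_sftZ [TopologicalSpace S] [Finite S] [DiscreteTopology S] [BorelSpace S] {N : ℕ}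
    {L : Set (Fin (N + 1) → S)} (h : IsBilateralExtension μ μZ)
    (hμ : ∀ᵐ x ∂μ, x ∈ sft N L) : ∀ᵐ x ∂μZ, x ∈ sftZ N L := by
  have : ∀ᵐ x ∂μZ, ∀ n, futureFrom n x ∈ sft N L := ae_all_iff.mpr fun n =>
    (h.measurePreserving_futureFrom n).quasiMeasurePreserving.ae hμ
  filter_upwards [this] with x hx
  exact mem_sftZ_of_forall_futureFrom hx

variable [MeasurableSingletonClass S]

lemma measureReal_pastCyl (h : IsBilateralExtension μ μZ) (x : ℤ → S) (n : ℕ) :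
    μZ.real (pastCyl x n) = μ.real (cyl (futureFrom n x) (n + 1)) := by
  rw [measureReal_def, measureReal_def, pastCyl,
    (h.measurePreserving_futureFrom n).measure_preimage
      (measurableSet_cyl _ _).nullMeasurableSet]

/-- The right side has the shape of the ratio estimate: a past word of length `n - m`, followed by a
subset of the cylinder of the `m + 1` letters at `-m, …, 0`. -/
lemma measureReal_inter_pastCyl (h : IsBilateralExtension μ μZ) (x : ℤ → S) {m n : ℕ}
    (hmn : m ≤ n) {B : Set (ℕ → S)} (hB : MeasurableSet B) :
    μZ.real (futureFrom m ⁻¹' B ∩ pastCyl x n) = μ.real (cyl (futureFrom n x) (n - m)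
      ∩ shift^[n - m] ⁻¹' (cyl (futureFrom m x) (m + 1) ∩ B)) := by
  have hset : futureFrom m ⁻¹' B ∩ pastCyl x n = futureFrom n ⁻¹' (cyl (futureFrom n x) (n - m)
      ∩ shift^[n - m] ⁻¹' (cyl (futureFrom m x) (m + 1) ∩ B)) := by
    have : n + 1 = (n - m) + (m + 1) := by omega
    ext y
    rw [pastCyl, this, cyl_add, shift_iterate_futureFrom hmn]
    simp only [Set.mem_inter_iff, Set.mem_preimage, shift_iterate_futureFrom hmn]
    tauto
  rw [measureReal_def, measureReal_def, hset,
    (h.measurePreserving_futureFrom n).measure_preimage]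
  exact ((measurableSet_cyl _ _).inter ((measurable_shift.iterate _)
    ((measurableSet_cyl _ _).inter hB))).nullMeasurableSet

end IsBilateralExtension

lemma HasGibbsProperty.measureReal_cyl_pos {Y : Set (ℕ → S)} {φ : (ℕ → S) → ℝ}
    {μ : Measure (ℕ → S)} (h : HasGibbsProperty Y φ μ) {x : ℕ → S} (hx : x ∈ Y) (n : ℕ) :
    0 < μ.real (cyl x n) := by
  obtain ⟨P, K, hK, h⟩ := h
  have h1 := (inv_pos.mpr hK).trans_le (h x hx n).1
  refine lt_of_le_of_ne measureReal_nonneg fun h0 => ?_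
  rw [← h0, zero_div] at h1
  exact lt_irrefl _ h1

end TwoSided

/-! ### From multiplicative bounds to relative differences. -/

section RelDiff

lemma relDiff_le {x y D : ℝ} (hx : 0 ≤ x) (hy : 0 ≤ y) (hD : 1 ≤ D) (hxy : x ≤ D * y)
    (hyx : y ≤ D * x) : relDiff x y ≤ ENNReal.ofReal (D - 1) := by
  unfold relDiff
  split_ifs with h1 h2
  · exact zero_le
  · exact absurd (le_antisymm (by simpa [h1] using hxy) hx) h2
  · have hy' : 0 < y := lt_of_le_of_ne hy (Ne.symm h1)
    refine ENNReal.ofReal_le_ofReal (abs_le.mpr ⟨?_, ?_⟩)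
    · have : 2 - D ≤ x / y := by
        rw [le_div_iff₀ hy']
        nlinarith [mul_nonneg (sub_nonneg.mpr hD) hx]
      linarith
    · have : x / y ≤ D := (div_le_iff₀ hy').mpr hxy
      linarith

lemma exp_mul_sub_one_le {t s : ℝ} (ht : 0 ≤ t) (hs0 : 0 ≤ s) (hs1 : s ≤ 1) :
    Real.exp (t * s) - 1 ≤ t * Real.exp t * s := by
  have h1 := Real.add_one_le_exp (-(t * s))
  have h2 : Real.exp (-(t * s)) * Real.exp (t * s) = 1 := by rw [← Real.exp_add]; simp
  have h3 : Real.exp (t * s) ≤ Real.exp t := Real.exp_le_exp.mpr (mul_le_of_le_one_right ht hs1)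
  have h4 : t * s * Real.exp (t * s) ≤ t * s * Real.exp t := by gcongr
  nlinarith [Real.exp_pos (t * s)]

end RelDiff

/-! ### Comparison of versions. -/

section Versions

variable {S : Type*} [MeasurableSpace S]

lemma IsCondProbGivenPast.ae_eq_of_isFutureEvent [Finite S] {μZ : Measure (ℤ → S)}
    {p q : Set (ℤ → S) → (ℤ → S) → ℝ}
    (hp : IsCondProbGivenPast μZ p) (hq : IsCondProbGivenPast μZ q) :
    ∀ᵐ x ∂μZ, ∀ A, IsFutureEvent A → p A x = q A x :=
  (ae_ball_iff countable_isFutureEvent).mpr fun A hA => (hp A hA).2.trans (hq A hA).2.symm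

lemma gam_le_of_eq {p q : Set (ℤ → S) → (ℤ → S) → ℝ} {G H : Set (ℤ → S)} (hGH : G ⊆ H)
    (h : ∀ x ∈ G, ∀ A, IsFutureEvent A → p A x = q A x) (m : ℕ) : gam p G m ≤ gam q H m := by
  refine iSup₂_le fun A hA => iSup₂_le fun x hx => iSup₂_le fun y hy => iSup_le fun hxy => ?_
  rw [h x hx A hA, h y hy A hA]
  exact le_iSup₂_of_le A hA <| le_iSup₂_of_le x (hGH hx) <| le_iSup₂_of_le y (hGH hy) <|
    le_iSup_of_le hxy le_rfl

end Versions

/-! ### The regularity estimate on the two-sided subshift. -/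

section Main

variable {S : Type*} [Finite S] [TopologicalSpace S] [DiscreteTopology S]
  [MeasurableSpace S] [BorelSpace S]
  {N : ℕ} {L : Set (Fin (N + 1) → S)} {φ : (ℕ → S) → ℝ} {ρ : ℝ}
  {μ : Measure (ℕ → S)} {μZ : Measure (ℤ → S)}

theorem exists_pastProb_le_mul (hρ0 : 0 < ρ) (hρ1 : ρ < 1) (hφ : IsHolder ρ (sft N L) φ)
    (hμ : IsInvariantGibbs (sft N L) φ μ) (hμZ : IsBilateralExtension μ μZ) :
    ∃ t : ℝ, 0 ≤ t ∧ ∀ m : ℕ, N ≤ m + 1 → ∀ A, IsFutureEvent A →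
      ∀ x ∈ sftZ N L, ∀ y ∈ sftZ N L, (∀ i : ℤ, -(m : ℤ) ≤ i → i ≤ 0 → x i = y i) →
        pastProb μZ A x ≤ Real.exp (t * ρ ^ m) * pastProb μZ A y := by
  have := hμ.prob
  have := hμZ.isProbabilityMeasure
  obtain ⟨t, ht, hcross⟩ := hμ.exists_cross_ratio_le hρ0 hρ1 hφ
  refine ⟨t, ht, fun m hm A hA x hx y hy hxy => ?_⟩
  obtain ⟨B, hB, rfl⟩ := hA.exists_eq_preimage m
  refine pastProb_le_mul (Real.exp_pos _) (m := m) fun n hn n' hn' => ?_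
  have hcyl : cyl (futureFrom m y) (m + 1) = cyl (futureFrom m x) (m + 1) :=
    (cyl_eq_of_mem (mem_pastCyl.mpr hxy)).symm
  -- The Gibbs property gives positive mass to every cylinder of a point of the subshift, so the
  -- ratios are genuine quotients at every such point, not only almost everywhere.
  have hpos : ∀ {w : ℤ → S}, w ∈ sftZ N L → ∀ n, 0 < μ.real (cyl (futureFrom n w) (n + 1)) :=
    fun hw n => hμ.gibbs.measureReal_cyl_pos (futureFrom_mem_sft hw n) _
  rw [pastRatio, pastRatio, hμZ.measureReal_inter_pastCyl x hn hB,
    hμZ.measureReal_inter_pastCyl y hn' hB, hμZ.measureReal_pastCyl, hμZ.measureReal_pastCyl, hcyl,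
    ← mul_div_assoc, div_le_div_iff₀ (hpos hx n) (hpos hy n')]
  have key := hcross m hm (n - m) (n' - m) (futureFrom n x) (futureFrom n' y)
    (cyl (futureFrom m x) (m + 1) ∩ B) ((measurableSet_cyl _ _).inter hB)
    (by rw [shift_iterate_futureFrom hn, shift_iterate_futureFrom hn', hcyl])
    (by rw [shift_iterate_futureFrom hn]; exact Set.inter_subset_left)
  rw [show n - m + (m + 1) = n + 1 by omega, show n' - m + (m + 1) = n' + 1 by omega] at key
  have key' := ENNReal.toReal_mono (by finiteness) key
  rw [ENNReal.toReal_mul, ENNReal.toReal_mul, ENNReal.toReal_mul,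
    ENNReal.toReal_ofReal (Real.exp_pos _).le] at key'
  simp only [← measureReal_def] at key'
  rwa [mul_assoc]

/-- The version `pastProb` of the conditional probabilities satisfies the regularity estimate on
the whole two-sided subshift. -/
theorem exists_gam_pastProb_lt (hρ0 : 0 < ρ) (hρ1 : ρ < 1) (hφ : IsHolder ρ (sft N L) φ)
    (hμ : IsInvariantGibbs (sft N L) φ μ) (hμZ : IsBilateralExtension μ μZ) :
    ∃ C : ℝ, ∀ m : ℕ, N ≤ m + 1 →
      gam (pastProb μZ) (sftZ N L) m < ENNReal.ofReal (C * ρ ^ m) := by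
  have := hμ.prob
  have := hμZ.isProbabilityMeasure
  obtain ⟨t, ht, h⟩ := exists_pastProb_le_mul hρ0 hρ1 hφ hμ hμZ
  -- The summand `1` makes the inequality strict, even when `t = 0`.
  refine ⟨t * Real.exp t + 1, fun m hm => ?_⟩
  have hρm : 0 < ρ ^ m := by positivity
  have hle : gam (pastProb μZ) (sftZ N L) m ≤ ENNReal.ofReal (t * Real.exp t * ρ ^ m) := by
    refine iSup₂_le fun A hA => iSup₂_le fun x hx => iSup₂_le fun y hy => iSup_le fun hxy => ?_
    refine (relDiff_le (pastProb_nonneg μZ A x) (pastProb_nonneg μZ A y)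
      (Real.one_le_exp (by positivity)) (h m hm A hA x hx y hy hxy)
      (h m hm A hA y hy x hx fun i hi hi' => (hxy i hi hi').symm)).trans
      (ENNReal.ofReal_le_ofReal ?_)
    exact exp_mul_sub_one_le ht hρm.le (pow_le_one₀ hρ0.le hρ1.le)
  refine hle.trans_lt ((ENNReal.ofReal_lt_ofReal_iff (by positivity)).mpr ?_)
  nlinarith

end Main

end GibbsSFT

end

theorem mainTheorem9 {S : Type*} [Finite S] [TopologicalSpace S] [DiscreteTopology S]
    [MeasurableSpace S] [BorelSpace S]
    (N : ℕ) (L : Set (Fin (N + 1) → S)) (hY : GibbsSFT.TopTransitive (GibbsSFT.sft N L))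
    (ρ : ℝ) (hρ0 : 0 < ρ) (hρ1 : ρ < 1)
    (φ : (ℕ → S) → ℝ) (hφ : GibbsSFT.IsHolder ρ (GibbsSFT.sft N L) φ)
    (μ : Measure (ℕ → S)) (hμ : GibbsSFT.IsInvariantGibbs (GibbsSFT.sft N L) φ μ)
    (μZ : Measure (ℤ → S)) (hμZ : GibbsSFT.IsBilateralExtension μ μZ) :
    ∃ C : ℝ,
      (∃ p, GibbsSFT.IsCondProbGivenPast μZ p ∧
        ∀ m : ℕ, N ≤ m + 1 →
          GibbsSFT.gam p (GibbsSFT.sftZ N L) m < ENNReal.ofReal (C * ρ ^ m)) ∧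
      (∀ p, GibbsSFT.IsCondProbGivenPast μZ p →
        ∃ G : Set (ℤ → S), (∀ᵐ x ∂μZ, x ∈ G) ∧
          ∀ m : ℕ, N ≤ m + 1 →
            GibbsSFT.gam p G m < ENNReal.ofReal (C * ρ ^ m)) := by
  have := hμ.prob
  have := hμZ.isProbabilityMeasure
  obtain ⟨C, hC⟩ := GibbsSFT.exists_gam_pastProb_lt hρ0 hρ1 hφ hμ hμZ
  have hq : GibbsSFT.IsCondProbGivenPast μZ (GibbsSFT.pastProb μZ) :=
    GibbsSFT.isCondProbGivenPast_pastProb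
  refine ⟨C, ⟨_, hq, hC⟩, fun p hp => ⟨{x | x ∈ GibbsSFT.sftZ N L ∧
    ∀ A, GibbsSFT.IsFutureEvent A → p A x = GibbsSFT.pastProb μZ A x}, ?_, fun m hm => ?_⟩⟩
  · filter_upwards [hμZ.ae_mem_sftZ hμ.carried, hp.ae_eq_of_isFutureEvent hq] with x hx hpx
    exact ⟨hx, hpx⟩
  · exact (GibbsSFT.gam_le_of_eq (fun x hx => hx.1) (fun x hx => hx.2) m).trans_lt (hC m hm)
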